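/- **Setting.** A sublinear expectation space $(\Omega,\mathcal H,\overline{\mathbf E})$ consists of a set $\Omega$, a linear space $\mathcal H$ of real functions on $\Omega$ containing the constants, and a functional $\overline{\mathbf E}:\mathcal H\to\mathbb R$ with: $\overline{\mathbf E}[X]\le\overline{\mathbf E}[Y]$ if $X\le Y$; $\overline{\mathbf E}[c]=c$ for constants $c$; $\overline{\mathbf E}[X+Y]\le\overline{\mathbf E}[X]+\overline{\mathbf E}[Y]$; $\overline{\mathbf E}[\lambda X]=\lambda\overline{\mathbf E}[X]$ for $\lambda\ge0$. Put $\underline{\mathbf E}[X]=-\overline{\mathbf E}[-X]$, and for an arbitrary $g:\Omega\to\mathbb R$ put $\overline{\mathbf E}[g]=\inf\{\overline{\mathbf E}[Y]:Y\ge g,\ Y\in\mathcal H\}$ with $\inf\emptyset=\infty$. Let $X_0,X_1,X_2,\dots$ be functions $\Omega\to\mathbb R$, $\vec X_k=(X_1,\dots,X_k)$, such that $X_1,X_2,\dots$ are i.i.d. with $X_0$: for every $k\ge1$ and every bounded continuous $\psi:\mathbb R\to\mathbb R$, $\psi(X_k),\psi(X_0)\in\mathcal H$ and $\overline{\mathbf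 E}[\psi(X_k)]=\overline{\mathbf E}[\psi(X_0)]$; and for every $k\ge2$ and every bounded continuous $\psi:\mathbb R^{k-1}\times\mathbb R\to\mathbb R$, $\psi(\vec X_{k-1},X_k)\in\mathcal H$ and $\overline{\mathbf E}[\psi(\vec X_{k-1},X_k)]=\overline{\mathbf E}\big[\overline{\mathbf E}[\psi(\vec x,X_k)]|_{\vec x=\vec X_{k-1}}\big]$ (the inner expectation, as a function on $\Omega$, being in $\mathcal H$). Assume $X_0,X_0^2\in\mathcal H$. Let $\underline\mu=\underline{\mathbf E}[X_0]$, $\overline\mu=\overline{\mathbf E}[X_0]$, and for $\mu\in[\underline\mu,\overline\mu]$ let $\underline\sigma(\mu),\overline\sigma(\mu)\ge0$ be given by $\underline\sigma^2(\mu)=\underline{\mathbf E}[(X_0-\mu)^2]$, $\overline\sigma^2(\mu)=\overline{\mathbf E}[(X_0-\mu)^2]$. Assume $$0<\underline\sigma:=\inf_{\mu\in[\underline\mu,\overline\mu]}\underline\sigma(\mu)\le\overline\sigma:=\sup_{\mu\in[\underline\mu,\overline\mu]}\overline\sigma(\mu)<\infty .$$ For $p\ge2$ and $C>0$ let $$\gamma_p(C)=\sup_{\mu\in[\underline\mu,\overline\mu]}\overline{\mathbf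 E}\big[\min\{|\xi_0(\mu)|^p,\ C^{p-2}\xi_0(\mu)^2\}\big],\qquad \xi_0(\mu)=\frac{X_0-\mu}{\underline\sigma(\mu)},$$ which is finite, and for $n\ge1$ $$\tilde\Pi_{n,p}=\frac{4.7\,\big(\gamma_p(\sqrt n)\big)^{1/(p+1)}}{n^{(p-2)/(2p+2)}} .$$ Let $\mathcal M_n$ be the set of all sequences $\{(\mu_i,\sigma_i)\}_{i=1}^n$ where $\mu_i=\mu_i(\vec X_{i-1})$ and $\sigma_i=\sigma_i(\vec X_{i-1})$ are continuous functions of $i-1$ real variables with $$\underline\mu\le\mu_i\le\overline\mu,\qquad \underline\sigma\le\underline\sigma(\mu_i)\le\sigma_i\le\overline\sigma(\mu_i)\le\overline\sigma,\qquad i=1,\dots,n .$$ For such a sequence let $S_n$ be the random broken line in $C[0,1]$, linear on each $[\frac{k-1}n,\frac kn]$, with $S_n(0)=0$ and $S_n(k/n)=\frac1{\sqrt n}\sum_{i=1}^k\frac{X_i-\mu_i}{\sigma_i}$, $k=1,\dots,n$. For $D\subset C[0,1]$ let $$\overline{\mathbf P}(S_n\in D)=\inf\{\overline{\mathbf E}[\psi(\vec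 X_n)]:\ \psi:\mathbb R^n\to\mathbb R,\ \psi(\vec X_n)\in\mathcal H,\ \psi(\vec X_n)\ge\mathbf 1(S_n\in D)\}.$$ **Claim.** Let $B$ be a standard Wiener process on $[0,1]$ with continuous paths, defined on a classical probability space with probability $\mathbf P$. Let $f:C[0,1]\to\mathbb R$ and $L,K\in\mathbb R$ satisfy $|f(x)-f(y)|\le L\|x-y\|$ for all $x,y\in C[0,1]$ (uniform norm) and $\mathbf P(a\le f(B)\le a+h)\le Kh$ for all $a\in\mathbb R$, $h\ge0$. Then for all integers $n\ge1$, all $p\in[2,3]$ and all $a\in\mathbb R$, $$\inf_{\{(\mu_i,\sigma_i)\}\in\mathcal M_n}\overline{\mathbf P}\big(f(S_n)\le a\big)-\mathbf P\big(f(B)\le a\big)\le(KL+1)\,\tilde\Pi_{n,p}.$$ -/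

import Mathlib

open MeasureTheory ProbabilityTheory Set
open scoped unitInterval BoundedContinuousFunction

/-- A sublinear expectation space `(Ω, H, E)`: `H` is a linear space of real functions on `Ω`
containing the constants and `E` is a monotone, constant preserving, sub-additive and positively
homogeneous functional on `H`. (`E` is written as a total function; it is only ever evaluated
at elements of `H`, and only its values there are constrained.) -/
structure SublinearExpectation (Ω : Type*) where
  H : Submodule ℝ (Ω → ℝ)
  E : (Ω → ℝ) → ℝ
  const_mem : ∀ c : ℝ, (fun _ => c) ∈ H
  mono : ∀ X ∈ H, ∀ Y ∈ H, (∀ ω, X ω ≤ Y ω) → E X ≤ E Y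
  const : ∀ c : ℝ, E (fun _ => c) = c
  subadd : ∀ X ∈ H, ∀ Y ∈ H, E (X + Y) ≤ E X + E Y
  pos_homog : ∀ r : ℝ, 0 ≤ r → ∀ X ∈ H, E (r • X) = r * E X

namespace SublinearExpectation

variable {Ω : Type*} (S : SublinearExpectation Ω)

/-- The lower expectation `-E[-X]`. -/
def lowerE (X : Ω → ℝ) : ℝ := -S.E (-X)

/-- The extension of `E` to arbitrary functions on `Ω` by `inf {E[Y] : Y ≥ g, Y ∈ H}`,
with `inf ∅ = ∞`. -/
noncomputable def extE (g : Ω → ℝ) : EReal :=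
  sInf {e : EReal | ∃ Y ∈ S.H, (∀ ω, g ω ≤ Y ω) ∧ e = (S.E Y : EReal)}

/-- `Y` is independent to `X`: for all bounded continuous `ψ`,
`E[ψ(X, Y)] = E[ E[ψ(x, Y)]|_{x = X} ]`, all expectations being taken of elements of `H`.
(Each section `ψ(x, Y)` is in `H` by the first clause applied to `(x', y) ↦ ψ(x, y)`.) -/
def IndepTo {α β : Type*} [TopologicalSpace α] [TopologicalSpace β]
    (Y : Ω → β) (X : Ω → α) : Prop :=
  ∀ ψ : (α × β) →ᵇ ℝ,
    (fun ω => ψ (X ω, Y ω)) ∈ S.H ∧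
    (fun ω => S.E (fun ω' => ψ (X ω, Y ω'))) ∈ S.H ∧
    S.E (fun ω => ψ (X ω, Y ω)) = S.E (fun ω => S.E (fun ω' => ψ (X ω, Y ω')))

/-- `X` and `Y` are identically distributed: `E[ψ(X)] = E[ψ(Y)]` for all bounded continuous `ψ`. -/
def SameDistrib (X Y : Ω → ℝ) : Prop :=
  ∀ ψ : ℝ →ᵇ ℝ, (fun ω => ψ (X ω)) ∈ S.H ∧ (fun ω => ψ (Y ω)) ∈ S.H ∧
    S.E (fun ω => ψ (X ω)) = S.E (fun ω => ψ (Y ω))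

end SublinearExpectation

/-- The vector `(X₁, …, X_k)`. -/
def initialVec {Ω : Type*} (X : ℕ → Ω → ℝ) (k : ℕ) (ω : Ω) : Fin k → ℝ :=
  fun i => X (i + 1) ω

namespace SublinearExpectation

variable {Ω : Type*} (S : SublinearExpectation Ω)

/-- `X₁, X₂, …` are i.i.d. with `X₀` (here `X₀ = X 0`). -/
structure IsIIDWith (X : ℕ → Ω → ℝ) : Prop where
  sameDistrib : ∀ k, 1 ≤ k → S.SameDistrib (X k) (X 0)
  indep : ∀ k, 1 ≤ k → S.IndepTo (X (k + 1)) (initialVec X k)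

/-- The interval of means, from `-E[-X₀]` to `E[X₀]`. -/
def meanInterval (X₀ : Ω → ℝ) : Set ℝ := Icc (S.lowerE X₀) (S.E X₀)

/-- The lower standard deviation about `μ`: its square is `-E[-(X₀ - μ)²]`. -/
noncomputable def sdLower (X₀ : Ω → ℝ) (μ : ℝ) : ℝ :=
  Real.sqrt (S.lowerE (fun ω => (X₀ ω - μ) ^ 2))

/-- The upper standard deviation about `μ`: its square is `E[(X₀ - μ)²]`. -/
noncomputable def sdUpper (X₀ : Ω → ℝ) (μ : ℝ) : ℝ :=
  Real.sqrt (S.E (fun ω => (X₀ ω - μ) ^ 2))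

/-- The infimum of the lower standard deviations over the interval of means. -/
noncomputable def sdInf (X₀ : Ω → ℝ) : ℝ := sInf (S.sdLower X₀ '' S.meanInterval X₀)

/-- The supremum of the upper standard deviations over the interval of means. -/
noncomputable def sdSup (X₀ : Ω → ℝ) : ℝ := sSup (S.sdUpper X₀ '' S.meanInterval X₀)

/-- The moment assumption: `X₀, X₀² ∈ H` and `0 < sdInf ≤ sdSup < ∞`
(the middle inequality is automatic). -/
structure MomentCondition (X₀ : Ω → ℝ) : Prop where
  mem : X₀ ∈ S.H
  sq_mem : (fun ω => X₀ ω ^ 2) ∈ S.H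
  sdInf_pos : 0 < S.sdInf X₀
  sdSup_finite : BddAbove (S.sdUpper X₀ '' S.meanInterval X₀)

/-- `γ_p(μ, C) = E[ |ξ|^p ∧ C^{p-2} ξ² ]` for `ξ = (X₀ - μ) / sdLower(μ)`. -/
noncomputable def gammaAt (X₀ : Ω → ℝ) (p μ C : ℝ) : EReal :=
  S.extE (fun ω => min (|(X₀ ω - μ) / S.sdLower X₀ μ| ^ p)
    (C ^ (p - 2) * ((X₀ ω - μ) / S.sdLower X₀ μ) ^ 2))

/-- `γ_p(C)`, the supremum of `γ_p(μ, C)` over the interval of means. -/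
noncomputable def gammaSup (X₀ : Ω → ℝ) (p C : ℝ) : EReal :=
  ⨆ μ ∈ S.meanInterval X₀, S.gammaAt X₀ p μ C

/-- The rate `4.7 γ_p(√n)^{1/(p+1)} / n^{(p-2)/(2p+2)}`. Under the moment assumption
`0 ≤ γ_p(√n) < ∞` for `n ≥ 1` and `p ≥ 2`, so that `toReal` loses nothing. -/
noncomputable def prokhorovRate (X₀ : Ω → ℝ) (n : ℕ) (p : ℝ) : ℝ :=
  4.7 * (S.gammaSup X₀ p (Real.sqrt n)).toReal ^ (1 / (p + 1)) /
    (n : ℝ) ^ ((p - 2) / (2 * p + 2))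

end SublinearExpectation

/-- A choice, for `i = 1, …, n`, of functions `μ_i` (`mean`) and `σ_i` (`sd`) of `i - 1` real variables
(index `i : Fin n` stands for `i + 1`). -/
structure Normalization (n : ℕ) where
  mean : (i : Fin n) → (Fin (i : ℕ) → ℝ) → ℝ
  sd : (i : Fin n) → (Fin (i : ℕ) → ℝ) → ℝ

/-- The set of admissible sequences of pairs `(μ_i, σ_i)`: continuous functions satisfying
`-E[-X₀] ≤ μ_i ≤ E[X₀]` and
`sdInf ≤ sdLower(μ_i) ≤ σ_i ≤ sdUpper(μ_i) ≤ sdSup`. -/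
def SublinearExpectation.admissible {Ω : Type*} (S : SublinearExpectation Ω) (X₀ : Ω → ℝ)
    (n : ℕ) : Set (Normalization n) :=
  {c | ∀ i : Fin n, Continuous (c.mean i) ∧ Continuous (c.sd i) ∧
    ∀ x : Fin (i : ℕ) → ℝ,
      c.mean i x ∈ S.meanInterval X₀ ∧
      S.sdInf X₀ ≤ S.sdLower X₀ (c.mean i x) ∧
      S.sdLower X₀ (c.mean i x) ≤ c.sd i x ∧
      c.sd i x ≤ S.sdUpper X₀ (c.mean i x) ∧
      S.sdUpper X₀ (c.mean i x) ≤ S.sdSup X₀}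

/-- The broken line on `[0,1]` starting at `0`, with nodes `k/n` and increments `z₁, …, z_n`:
the `i`-th increment is multiplied by a function which is `0` up to `(i-1)/n`, `1` from `i/n` on
and linear in between. -/
noncomputable def brokenLine {n : ℕ} (z : Fin n → ℝ) : C(I, ℝ) where
  toFun t := ∑ i : Fin n, z i * max 0 (min 1 ((n : ℝ) * (t : ℝ) - (i : ℕ)))
  continuous_toFun := by fun_prop

/-- On `[k/n, (k+1)/n]` the broken line interpolates linearly between the partial sums. -/
theorem brokenLine_apply {n : ℕ} (z : Fin n → ℝ) (k : Fin n) (t : I)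
    (h₁ : ((k : ℕ) : ℝ) ≤ n * (t : ℝ)) (h₂ : (n : ℝ) * (t : ℝ) ≤ (k : ℕ) + 1) :
    brokenLine z t = (∑ i ∈ Finset.Iio k, z i) + (n * (t : ℝ) - (k : ℕ)) * z k := by
  have key : ∀ i : Fin n, z i * max 0 (min 1 ((n : ℝ) * (t : ℝ) - (i : ℕ))) =
      (if i < k then z i else 0) + (if i = k then (n * (t : ℝ) - (k : ℕ)) * z k else 0) := by
    intro i
    rcases lt_trichotomy i k with h | h | h
    · have h' : ((i : ℕ) : ℝ) + 1 ≤ (k : ℕ) := by exact_mod_cast h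
      rw [if_pos h, if_neg h.ne, min_eq_left (by linarith), max_eq_right zero_le_one]
      ring
    · subst h
      rw [if_neg (lt_irrefl _), if_pos rfl, min_eq_right (by linarith),
        max_eq_right (by linarith)]
      ring
    · have h' : ((k : ℕ) : ℝ) + 1 ≤ (i : ℕ) := by exact_mod_cast h
      rw [if_neg (not_lt.2 h.le), if_neg h.ne', min_eq_right (by linarith),
        max_eq_left (by linarith)]
      ring
  change ∑ i : Fin n, z i * max 0 (min 1 ((n : ℝ) * (t : ℝ) - (i : ℕ))) = _
  rw [Finset.sum_congr rfl fun i _ => key i, Finset.sum_add_distrib, ← Finset.sum_filter]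
  congr 1
  · congr 1
    ext i
    simp
  · simp

/-- The random broken line `S_n` with
`S_n(k/n) = n^{-1/2} ∑_{i ≤ k} (X_i - μ_i) / σ_i`, where `μ_i = μ_i(X₁, …, X_{i-1})` and
`σ_i = σ_i(X₁, …, X_{i-1})`. -/
noncomputable def randomLine {Ω : Type*} (X : ℕ → Ω → ℝ) {n : ℕ} (c : Normalization n)
    (ω : Ω) : C(I, ℝ) :=
  brokenLine fun i : Fin n =>
    1 / Real.sqrt n * ((X ((i : ℕ) + 1) ω - c.mean i (initialVec X i ω)) / c.sd i (initialVec X i ω))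

/-- The upper probability of an event:
`inf {E[ψ(X₁, …, X_n)] : ψ(X₁, …, X_n) ≥ 1_A, ψ(X₁, …, X_n) ∈ H}`. -/
noncomputable def SublinearExpectation.upperProb {Ω : Type*} (S : SublinearExpectation Ω)
    (X : ℕ → Ω → ℝ) (n : ℕ) (A : Set Ω) : ℝ :=
  sInf {e : ℝ | ∃ ψ : (Fin n → ℝ) → ℝ, (fun ω => ψ (initialVec X n ω)) ∈ S.H ∧
    (∀ ω, A.indicator (fun _ => (1 : ℝ)) ω ≤ ψ (initialVec X n ω)) ∧
    e = S.E (fun ω => ψ (initialVec X n ω))}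

/-- A standard Wiener process on `[0,1]` with continuous paths. -/
structure IsWienerProcess {Ω : Type*} [MeasurableSpace Ω] (B : Ω → C(I, ℝ)) (P : Measure Ω) :
    Prop where
  zero : ∀ᵐ ω ∂P, B ω 0 = 0
  indepIncrements : HasIndepIncrements (fun (t : I) ω => B ω t) P
  increments : ∀ s t : I, s ≤ t →
    HasLaw (fun ω => B ω t - B ω s) (gaussianReal 0 (Real.toNNReal ((t : ℝ) - (s : ℝ)))) P

/-! The proof is a Lindeberg replacement along a stochastic control problem. The normalization is
free, so it can steer: where the current value function has slope `b` and curvature `c`, centring at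
the upper mean when `b > 0` and at the lower mean when `b < 0` gives the linear Taylor term zero
upper expectation. Likewise, normalizing by the upper deviation when `c > 0` and by the lower one
when `c < 0` gives the quadratic term the value it has under unit variance. Admissible rules must be
continuous, so the switches are replaced by steep ramps, at arbitrarily small cost
(`E_quadratic_le`). One observation can thus be exchanged for a Gaussian increment of variance `1/n`
up to a third order remainder, controlled by the truncated moment `γ_p`
(`exists_smoothMean_step_le`).

A value function with three derivatives is needed although `f` is only Lipschitz, and smoothing
afresh at each step would add up `n` smoothing errors. Instead the path is accompanied by a Gaussian
shadow walk. Before each step the increment of the path may be chosen adversarially, as long as path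
and shadow stay within `r`; `shadowValue` is the value of this game. Its average over a smooth
random relative position, supported in `[-r, r]`, is `smoothValue`. A path increment `y` with
relative position `t` is one of the adversary's options for the shadow increment `y + t`, so the
smoothed value after a step is at most a smooth function of the increment (`smoothValue_update_le`).
The Gaussian average of that function is exactly the preceding smoothed value
(`integral_smoothMean_shadowStep`). Smoothing is therefore paid for once: at the end the path is
within `2r = 3h` of a Gaussian walk from the origin (`ofReal_smoothValue_le`).

That walk is realised by the values of `B` at the times `j/n`, and its broken line is close to `B`
by a maximal inequality (`measure_norm_sub_brokenLine_gt_le`). The Lipschitz bound on `f` and the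
anti-concentration of `f(B)` turn distances into probability. Width `h = ε/4`, with `ε` the rate,
balances the errors. -/

/-! ### Smoothing by three window means, with explicit Taylor remainders -/

section WindowMean

/-- The mean of `F` over the window of length `h` centred at `y`. -/
noncomputable def windowMean (h : ℝ) (F : ℝ → ℝ) (y : ℝ) : ℝ :=
  ∫ t in (-(1 / 2 : ℝ))..(1 / 2), F (y + h * t)

theorem continuous_windowMean_uncurry {α : Type*} [TopologicalSpace α] [FirstCountableTopology α]
    (h : ℝ) {F : α → ℝ → ℝ}
    (hF : Continuous fun q : α × ℝ => F q.1 q.2) :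
    Continuous fun q : α × ℝ => windowMean h (F q.1) q.2 := by
  unfold windowMean
  apply intervalIntegral.continuous_parametric_intervalIntegral_of_continuous'
  exact hF.comp (by fun_prop : Continuous fun u : (α × ℝ) × ℝ => (u.1.1, u.1.2 + h * u.2))

theorem continuous_windowMean (h : ℝ) {F : ℝ → ℝ} (hF : Continuous F) :
    Continuous (windowMean h F) :=
  (continuous_windowMean_uncurry (α := Unit) h (F := fun _ => F) (by fun_prop)).comp
    (by fun_prop : Continuous fun y : ℝ => ((), y))

theorem windowMean_const (h c y : ℝ) : windowMean h (fun _ => c) y = c := by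
  simp only [windowMean, intervalIntegral.integral_const, smul_eq_mul]
  ring

theorem windowMean_mono {h : ℝ} (hh : 0 ≤ h) {F G : ℝ → ℝ} (hF : Continuous F) (hG : Continuous G)
    {ρ y : ℝ} (hFG : ∀ t, |t| ≤ ρ + h / 2 → F t ≤ G t) (hy : |y| ≤ ρ) :
    windowMean h F y ≤ windowMean h G y := by
  apply intervalIntegral.integral_mono_on (by norm_num)
  · exact Continuous.intervalIntegrable (by fun_prop) _ _
  · exact Continuous.intervalIntegrable (by fun_prop) _ _
  · intro t ht
    apply hFG
    calc |y + h * t| ≤ |y| + |h * t| := abs_add_le _ _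
      _ ≤ ρ + h / 2 := by
        rw [abs_mul, abs_of_nonneg hh]
        have : |t| ≤ 1 / 2 := abs_le.2 ⟨ht.1, ht.2⟩
        nlinarith

theorem windowMean_comp_add (h : ℝ) (F : ℝ → ℝ) (c y : ℝ) :
    windowMean h (fun t => F (c + t)) y = windowMean h F (c + y) := by
  simp only [windowMean, add_assoc]

theorem windowMean_mem_Icc {h : ℝ} (hh : 0 ≤ h) {F : ℝ → ℝ} (hF : Continuous F)
    (h01 : ∀ t, F t ∈ Icc (0 : ℝ) 1) (y : ℝ) : windowMean h F y ∈ Icc (0 : ℝ) 1 := by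
  constructor
  · rw [← windowMean_const h 0 y]
    exact windowMean_mono hh continuous_const hF (fun t _ => (h01 t).1) le_rfl
  · rw [← windowMean_const h 1 y]
    exact windowMean_mono hh hF continuous_const (fun t _ => (h01 t).2) le_rfl

theorem hasDerivAt_windowMean {h : ℝ} (hh : 0 < h) {F : ℝ → ℝ} (hF : Continuous F) (y : ℝ) :
    HasDerivAt (windowMean h F) ((F (y + h / 2) - F (y - h / 2)) / h) y := by
  have hG : ∀ u, HasDerivAt (fun u => ∫ t in (0 : ℝ)..u, F t) (F u) u := fun u =>
    intervalIntegral.integral_hasDerivAt_right (hF.intervalIntegrable _ _)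
      (hF.stronglyMeasurableAtFilter _ _) hF.continuousAt
  have key : windowMean h F = fun y =>
      ((∫ t in (0 : ℝ)..(y + h / 2), F t) - ∫ t in (0 : ℝ)..(y - h / 2), F t) / h := by
    ext y
    rw [windowMean, intervalIntegral.integral_comp_add_mul _ hh.ne',
      intervalIntegral.integral_interval_sub_left (hF.intervalIntegrable _ _)
        (hF.intervalIntegrable _ _), smul_eq_mul, inv_mul_eq_div]
    congr 2 <;> ring
  rw [key]
  have h1 := (hG (y + h / 2)).comp y ((hasDerivAt_id y).add_const (h / 2))
  have h2 := (hG (y - h / 2)).comp y ((hasDerivAt_id y).sub_const (h / 2))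
  simpa using (h1.sub h2).div_const h

theorem windowMean_integral_add {h : ℝ} {T : ℝ → ℝ} (hT : Continuous T)
    (h01 : ∀ t, T t ∈ Icc (0 : ℝ) 1) (ν : Measure ℝ) [IsProbabilityMeasure ν] (y : ℝ) :
    windowMean h (fun u => ∫ g, T (u + g) ∂ν) y = ∫ g, windowMean h T (y + g) ∂ν := by
  simp only [windowMean]
  rw [intervalIntegral.integral_of_le (by norm_num)]
  simp_rw [intervalIntegral.integral_of_le (show (-(1 / 2 : ℝ)) ≤ 1 / 2 by norm_num)]
  rw [MeasureTheory.integral_integral_swap]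
  · refine integral_congr_ae (.of_forall fun g => ?_)
    simp only [add_right_comm]
  · refine Integrable.of_bound (C := 1) ?_ (.of_forall fun q => ?_)
    · exact (Continuous.measurable (by fun_prop)).aestronglyMeasurable
    · simp only [Function.uncurry]
      rw [Real.norm_eq_abs, abs_of_nonneg (h01 _).1]
      exact (h01 _).2

/-- Three successive window means: the convolution of `F` with a `C²` density supported in
`[-3h/2, 3h/2]`. -/
noncomputable def smoothMean (h : ℝ) (F : ℝ → ℝ) : ℝ → ℝ :=
  windowMean h (windowMean h (windowMean h F))

/-- The first derivative of `smoothMean h F`. -/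
noncomputable def smoothMeanDeriv (h : ℝ) (F : ℝ → ℝ) (y : ℝ) : ℝ :=
  (windowMean h (windowMean h F) (y + h / 2) - windowMean h (windowMean h F) (y - h / 2)) / h

/-- The second derivative of `smoothMean h F`. -/
noncomputable def smoothMeanDeriv₂ (h : ℝ) (F : ℝ → ℝ) (y : ℝ) : ℝ :=
  (windowMean h F (y + h) - 2 * windowMean h F y + windowMean h F (y - h)) / h ^ 2

theorem hasDerivAt_smoothMean {h : ℝ} (hh : 0 < h) {F : ℝ → ℝ} (hF : Continuous F) (y : ℝ) :
    HasDerivAt (smoothMean h F) (smoothMeanDeriv h F y) y :=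
  hasDerivAt_windowMean hh (continuous_windowMean h (continuous_windowMean h hF)) y

theorem hasDerivAt_smoothMeanDeriv {h : ℝ} (hh : 0 < h) {F : ℝ → ℝ} (hF : Continuous F) (y : ℝ) :
    HasDerivAt (smoothMeanDeriv h F) (smoothMeanDeriv₂ h F y) y := by
  have hd := hasDerivAt_windowMean hh (continuous_windowMean h hF)
  have h1 := (hd (y + h / 2)).comp y ((hasDerivAt_id y).add_const (h / 2))
  have h2 := (hd (y - h / 2)).comp y ((hasDerivAt_id y).sub_const (h / 2))
  refine HasDerivAt.congr_deriv (f := smoothMeanDeriv h F) ((h1.sub h2).div_const h) ?_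
  simp only [smoothMeanDeriv₂, mul_one]
  rw [show y + h / 2 + h / 2 = y + h by ring, show y + h / 2 - h / 2 = y by ring,
    show y - h / 2 + h / 2 = y by ring, show y - h / 2 - h / 2 = y - h by ring]
  field_simp
  ring

/-- The derivative is a third difference of `F` over `h ^ 3`, with weights `1, -3, 3, -1`; values in
the unit interval keep the difference within `[-4, 4]`. -/
theorem exists_hasDerivAt_smoothMeanDeriv₂ {h : ℝ} (hh : 0 < h) {F : ℝ → ℝ} (hF : Continuous F)
    (h01 : ∀ t, F t ∈ Icc (0 : ℝ) 1) (y : ℝ) :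
    ∃ d, HasDerivAt (smoothMeanDeriv₂ h F) d y ∧ |d| ≤ 4 / h ^ 3 := by
  have hd := hasDerivAt_windowMean hh hF
  have h1 := (hd (y + h)).comp y ((hasDerivAt_id y).add_const h)
  have h2 := (hd (y - h)).comp y ((hasDerivAt_id y).sub_const h)
  refine ⟨_, ((h1.sub ((hd y).const_mul 2)).add h2).div_const (h ^ 2), ?_⟩
  simp only [mul_one]
  rw [show y - h + h / 2 = y - h / 2 by ring, show y + h - h / 2 = y + h / 2 by ring]
  have a1 := h01 (y + h + h / 2)
  have a2 := h01 (y + h / 2)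
  have a3 := h01 (y - h / 2)
  have a4 := h01 (y - h - h / 2)
  rw [show ((F (y + h + h / 2) - F (y + h / 2)) / h - 2 * ((F (y + h / 2) - F (y - h / 2)) / h) +
    (F (y - h / 2) - F (y - h - h / 2)) / h) / h ^ 2 =
    (F (y + h + h / 2) - 3 * F (y + h / 2) + 3 * F (y - h / 2) - F (y - h - h / 2)) / h ^ 3 by
      field_simp; ring, abs_div, abs_of_pos (pow_pos hh 3)]
  gcongr
  rw [abs_le]
  constructor <;> linarith [a1.1, a1.2, a2.1, a2.2, a3.1, a3.2, a4.1, a4.2]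

/-- A second difference of values in `[0, 1]` lies in `[-2, 2]`, so it oscillates by at most `4`.
This yields the quadratic remainder bound for large arguments. -/
theorem abs_smoothMeanDeriv₂_sub_le {h : ℝ} (hh : 0 < h) {F : ℝ → ℝ} (hF : Continuous F)
    (h01 : ∀ t, F t ∈ Icc (0 : ℝ) 1) (y z : ℝ) :
    |smoothMeanDeriv₂ h F y - smoothMeanDeriv₂ h F z| ≤ 4 / h ^ 2 := by
  have a := fun t => windowMean_mem_Icc hh.le hF h01 t
  simp only [smoothMeanDeriv₂]
  rw [← sub_div, abs_div, abs_of_pos (pow_pos hh 2)]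
  gcongr
  have a1 := a (y + h)
  have a2 := a y
  have a3 := a (y - h)
  have b1 := a (z + h)
  have b2 := a z
  have b3 := a (z - h)
  rw [abs_le]
  constructor <;>
    linarith [a1.1, a1.2, a2.1, a2.2, a3.1, a3.2, b1.1, b1.2, b2.1, b2.2, b3.1, b3.2]

/-- Integration of a bound on the derivative by a power. -/
theorem abs_le_of_abs_deriv_le_pow {f f' : ℝ → ℝ} (hf : ∀ t, HasDerivAt f (f' t) t) (h0 : f 0 = 0)
    {C : ℝ} {k : ℕ} (hf' : ∀ t, |f' t| ≤ C * |t| ^ k) (y : ℝ) :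
    |f y| ≤ C * |y| ^ (k + 1) / (k + 1) := by
  -- The one-sided bound on the half line holds because the difference of the two sides is monotone;
  -- applying it to `f`, `-f` and the reflection gives the rest.
  have pos : ∀ (g g' : ℝ → ℝ), (∀ t, HasDerivAt g (g' t) t) → g 0 = 0 →
      (∀ t, |g' t| ≤ C * |t| ^ k) → ∀ y, 0 ≤ y → g y ≤ C * y ^ (k + 1) / (k + 1) := by
    intro g g' hg hg0 hg' y hy
    have hd : ∀ t, HasDerivAt (fun t => C * t ^ (k + 1) / (k + 1) - g t) (C * t ^ k - g' t) t := by
      intro t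
      have := (((hasDerivAt_pow (k + 1) t).const_mul C).div_const ((k : ℝ) + 1)).sub (hg t)
      refine HasDerivAt.congr_deriv (f := fun t => C * t ^ (k + 1) / (k + 1) - g t) this ?_
      have : (k : ℝ) + 1 ≠ 0 := by positivity
      push_cast
      field_simp
    have hm : MonotoneOn (fun t => C * t ^ (k + 1) / (k + 1) - g t) (Ici 0) := by
      apply monotoneOn_of_deriv_nonneg (convex_Ici 0)
      · exact fun t _ => (hd t).continuousAt.continuousWithinAt
      · exact fun t _ => (hd t).differentiableAt.differentiableWithinAt
      · intro t ht
        rw [interior_Ici] at ht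
        rw [(hd t).deriv]
        have := (le_abs_self _).trans (hg' t)
        rw [abs_of_pos ht] at this
        linarith
    have := hm (mem_Ici.2 le_rfl) (mem_Ici.2 hy) hy
    simp only [hg0] at this
    simp at this
    linarith
  have hneg : ∀ (g g' : ℝ → ℝ), (∀ t, HasDerivAt g (g' t) t) → g 0 = 0 →
      (∀ t, |g' t| ≤ C * |t| ^ k) → ∀ y, 0 ≤ y → |g y| ≤ C * y ^ (k + 1) / (k + 1) := by
    intro g g' hg hg0 hg' y hy
    rw [abs_le']
    exact ⟨pos g g' hg hg0 hg' y hy, pos (fun t => -g t) (fun t => -g' t) (fun t => (hg t).neg)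
      (by simp [hg0]) (by simpa using hg') y hy⟩
  rcases le_total 0 y with hy | hy
  · rw [abs_of_nonneg hy]
    exact hneg f f' hf h0 hf' y hy
  · have := hneg (fun t => f (-t)) (fun t => -f' (-t))
      (fun t => ((hf (-t)).comp t (hasDerivAt_neg t)).congr_deriv (by simp)) (by simpa using h0)
      (fun t => by simpa using hf' (-t)) (-y) (by linarith)
    rw [abs_of_nonpos hy]
    simpa using this

/-- Two bounds on the Taylor remainder of order two of `smoothMean h F`. -/
theorem abs_smoothMean_taylor_le {h : ℝ} (hh : 0 < h) {F : ℝ → ℝ} (hF : Continuous F)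
    (h01 : ∀ t, F t ∈ Icc (0 : ℝ) 1) (x y : ℝ) :
    |smoothMean h F (x + y) - smoothMean h F x - smoothMeanDeriv h F x * y
      - smoothMeanDeriv₂ h F x / 2 * y ^ 2| ≤ min (2 / 3 * |y / h| ^ 3) (2 * (y / h) ^ 2) := by
  set w := smoothMean h F
  set w₁ := smoothMeanDeriv h F
  set w₂ := smoothMeanDeriv₂ h F
  have hshift : ∀ t : ℝ, HasDerivAt (fun t => x + t) 1 t := fun t =>
    (hasDerivAt_id t).const_add x
  have d1 : ∀ t, HasDerivAt (fun t => w₁ (x + t) - w₁ x - w₂ x * t) (w₂ (x + t) - w₂ x) t := by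
    intro t
    have := (((hasDerivAt_smoothMeanDeriv hh hF (x + t)).comp t (hshift t)).sub_const (w₁ x)).sub
      ((hasDerivAt_id t).const_mul (w₂ x))
    exact HasDerivAt.congr_deriv (f := fun t => w₁ (x + t) - w₁ x - w₂ x * t) this
      (by simp only [mul_one]; rfl)
  have d0 : ∀ t, HasDerivAt (fun t => w (x + t) - w x - w₁ x * t - w₂ x / 2 * t ^ 2)
      (w₁ (x + t) - w₁ x - w₂ x * t) t := by
    intro t
    have := ((((hasDerivAt_smoothMean hh hF (x + t)).comp t (hshift t)).sub_const (w x)).sub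
      ((hasDerivAt_id t).const_mul (w₁ x))).sub ((hasDerivAt_pow 2 t).const_mul (w₂ x / 2))
    refine HasDerivAt.congr_deriv
      (f := fun t => w (x + t) - w x - w₁ x * t - w₂ x / 2 * t ^ 2) this ?_
    simp
    ring
  choose w₃ hw₃ hw₃b using fun t => exists_hasDerivAt_smoothMeanDeriv₂ hh hF h01 t
  have d2 : ∀ t, HasDerivAt (fun t => w₂ (x + t) - w₂ x) (w₃ (x + t)) t := by
    intro t
    simpa using ((hw₃ (x + t)).comp t (hshift t)).sub_const (w₂ x)
  refine le_min ?_ ?_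
  · have b2 := fun t => abs_le_of_abs_deriv_le_pow (C := 4 / h ^ 3) (k := 0) d2 (by simp)
      (fun t => by simpa using hw₃b (x + t)) t
    have b1 := fun t => abs_le_of_abs_deriv_le_pow (C := 4 / h ^ 3) (k := 1) d1 (by simp)
      (fun t => by simpa using b2 t) t
    have b0 := abs_le_of_abs_deriv_le_pow (C := 4 / h ^ 3 / 2) (k := 2) d0 (by simp)
      (fun t => (b1 t).trans (le_of_eq (by norm_num; ring))) y
    refine b0.trans (le_of_eq ?_)
    rw [abs_div, abs_of_pos hh]
    field_simp
    norm_num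
    ring
  · have b1 := fun t => abs_le_of_abs_deriv_le_pow (C := 4 / h ^ 2) (k := 0) d1 (by simp)
      (fun t => by simpa using abs_smoothMeanDeriv₂_sub_le hh hF h01 (x + t) x) t
    have b0 := abs_le_of_abs_deriv_le_pow (C := 4 / h ^ 2) (k := 1) d0 (by simp)
      (fun t => by simpa using b1 t) y
    refine b0.trans (le_of_eq ?_)
    simp only [Nat.cast_one, Nat.reduceAdd, sq_abs]
    field_simp
    norm_num
    ring

/-- Each of the three windows reaches `h / 2` further, so only a neighbourhood of radius `3h/2` of
the origin matters. This is why the shadow radius is taken to be `3h/2`. -/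
theorem smoothMean_mono {h : ℝ} (hh : 0 ≤ h) {F G : ℝ → ℝ} (hF : Continuous F) (hG : Continuous G)
    (hFG : ∀ t, |t| ≤ 3 * h / 2 → F t ≤ G t) : smoothMean h F 0 ≤ smoothMean h G 0 := by
  have c1 := continuous_windowMean h hF
  have c2 := continuous_windowMean h hG
  refine windowMean_mono hh (continuous_windowMean h c1) (continuous_windowMean h c2) (ρ := 0)
    (fun t ht => ?_) (by simp)
  refine windowMean_mono hh c1 c2 (fun t ht => ?_) ht
  refine windowMean_mono hh hF hG (fun t ht => hFG t ?_) ht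
  linarith

theorem smoothMean_comp_add (h : ℝ) (F : ℝ → ℝ) (c y : ℝ) :
    smoothMean h (fun t => F (c + t)) y = smoothMean h F (c + y) := by
  have : ∀ F : ℝ → ℝ, windowMean h (fun t => F (c + t)) = fun y => windowMean h F (c + y) :=
    fun F => funext fun y => windowMean_comp_add h F c y
  simp only [smoothMean, this]

/-- Fubini, once per window: convolutions commute. -/
theorem smoothMean_integral_add {h : ℝ} (hh : 0 ≤ h) {T : ℝ → ℝ} (hT : Continuous T)
    (h01 : ∀ t, T t ∈ Icc (0 : ℝ) 1) (ν : Measure ℝ) [IsProbabilityMeasure ν] (y : ℝ) :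
    smoothMean h (fun u => ∫ g, T (u + g) ∂ν) y = ∫ g, smoothMean h T (y + g) ∂ν := by
  have c1 := continuous_windowMean h hT
  have m1 := windowMean_mem_Icc hh hT h01
  have e1 := funext (windowMean_integral_add (h := h) hT h01 ν)
  have e2 := funext (windowMean_integral_add (h := h) c1 m1 ν)
  rw [smoothMean, e1, e2, windowMean_integral_add (continuous_windowMean h c1)
    (windowMean_mem_Icc hh c1 m1) ν]
  rfl

theorem smoothMean_const (h c y : ℝ) : smoothMean h (fun _ => c) y = c := by
  have : windowMean h (fun _ => c) = fun _ => c := funext fun y => windowMean_const h c y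
  simp only [smoothMean, this]

theorem continuous_smoothMean_uncurry {α : Type*} [TopologicalSpace α] [FirstCountableTopology α]
    (h : ℝ) {F : α → ℝ → ℝ}
    (hF : Continuous fun q : α × ℝ => F q.1 q.2) :
    Continuous fun q : α × ℝ => smoothMean h (F q.1) q.2 :=
  continuous_windowMean_uncurry h (F := fun a => windowMean h (windowMean h (F a)))
    (continuous_windowMean_uncurry h (F := fun a => windowMean h (F a))
      (continuous_windowMean_uncurry h hF))

theorem smoothMean_mem_Icc {h : ℝ} (hh : 0 ≤ h) {F : ℝ → ℝ} (hF : Continuous F)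
    (h01 : ∀ t, F t ∈ Icc (0 : ℝ) 1) (y : ℝ) : smoothMean h F y ∈ Icc (0 : ℝ) 1 := by
  have c1 := continuous_windowMean h hF
  exact windowMean_mem_Icc hh (continuous_windowMean h c1)
    (windowMean_mem_Icc hh c1 (windowMean_mem_Icc hh hF h01)) y

theorem continuous_smoothMeanDeriv_uncurry {α : Type*} [TopologicalSpace α]
    [FirstCountableTopology α] (h : ℝ) {F : α → ℝ → ℝ}
    (hF : Continuous fun q : α × ℝ => F q.1 q.2) (y : ℝ) :
    Continuous fun a => smoothMeanDeriv h (F a) y := by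
  have c := continuous_windowMean_uncurry h (F := fun a => windowMean h (F a))
    (continuous_windowMean_uncurry h hF)
  exact ((c.comp (by fun_prop : Continuous fun a : α => (a, y + h / 2))).sub
    (c.comp (by fun_prop : Continuous fun a : α => (a, y - h / 2)))).div_const h

theorem continuous_smoothMeanDeriv₂_uncurry {α : Type*} [TopologicalSpace α]
    [FirstCountableTopology α] (h : ℝ) {F : α → ℝ → ℝ}
    (hF : Continuous fun q : α × ℝ => F q.1 q.2) (y : ℝ) :
    Continuous fun a => smoothMeanDeriv₂ h (F a) y := by
  have c := continuous_windowMean_uncurry h hF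
  exact (((c.comp (by fun_prop : Continuous fun a : α => (a, y + h))).sub
    ((c.comp (by fun_prop : Continuous fun a : α => (a, y))).const_mul 2)).add
    (c.comp (by fun_prop : Continuous fun a : α => (a, y - h)))).div_const (h ^ 2)

end WindowMean

/-! ### The shadow game and its smoothed value -/

section BackwardRecursion

open Function

/-- The best value of `Ψ` when the `k`-th increment of the path is chosen within distance `r`
of the increment `y` of its shadow, the new distance being the second argument of `Ψ`. -/
noncomputable def stepSup (r : ℝ) (k : ℕ) (Ψ : (ℕ → ℝ) → ℝ → ℝ) (z : ℕ → ℝ) (y : ℝ) : ℝ :=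
  sSup ((fun e => Ψ (update z k (y - e)) e) '' Icc (-r) r)

theorem exists_stepSup_eq {r : ℝ} (hr : 0 ≤ r) (k : ℕ) {Ψ : (ℕ → ℝ) → ℝ → ℝ}
    (hΨ : Continuous fun q : (ℕ → ℝ) × ℝ => Ψ q.1 q.2) (z : ℕ → ℝ) (y : ℝ) :
    ∃ e ∈ Icc (-r) r, stepSup r k Ψ z y = Ψ (update z k (y - e)) e := by
  apply isCompact_Icc.exists_sSup_image_eq (nonempty_Icc.2 (by linarith))
  refine Continuous.continuousOn ?_
  exact hΨ.comp ((continuous_const.update k (by fun_prop)).prodMk continuous_id)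

theorem le_stepSup {r : ℝ} (k : ℕ) {Ψ : (ℕ → ℝ) → ℝ → ℝ}
    (hΨ : Continuous fun q : (ℕ → ℝ) × ℝ => Ψ q.1 q.2) (z : ℕ → ℝ) (y : ℝ)
    {e : ℝ} (he : e ∈ Icc (-r) r) : Ψ (update z k (y - e)) e ≤ stepSup r k Ψ z y := by
  refine le_csSup (isCompact_Icc.bddAbove_image (Continuous.continuousOn ?_))
    (mem_image_of_mem (fun e => Ψ (update z k (y - e)) e) he)
  exact hΨ.comp ((continuous_const.update k (by fun_prop)).prodMk continuous_id)

theorem continuous_stepSup (r : ℝ) (k : ℕ) {Ψ : (ℕ → ℝ) → ℝ → ℝ}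
    (hΨ : Continuous fun q : (ℕ → ℝ) × ℝ => Ψ q.1 q.2) :
    Continuous fun q : (ℕ → ℝ) × ℝ => stepSup r k Ψ q.1 q.2 := by
  refine IsCompact.continuous_sSup (f := fun (q : (ℕ → ℝ) × ℝ) e => Ψ (update q.1 k (q.2 - e)) e)
    isCompact_Icc ?_
  exact hΨ.comp (((continuous_fst.comp continuous_fst).update k (by fun_prop)).prodMk
    continuous_snd)

/-- The value, `m` steps before the end of a path of length `n`, of the reward `Φ` of a path `z`
that stays within distance `r` of a shadow path with increments of law `ν`. The current position
of the shadow relative to the path is the second argument. -/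
noncomputable def shadowValue (ν : Measure ℝ) (r : ℝ) (n : ℕ) (Φ : (ℕ → ℝ) → ℝ) :
    ℕ → (ℕ → ℝ) → ℝ → ℝ
  | 0 => fun z _ => Φ z
  | m + 1 => fun z η => ∫ g, stepSup r (n - (m + 1)) (shadowValue ν r n Φ m) z (η + g) ∂ν

/-- The next shadow step before averaging, as a function of the history and of the increment. -/
noncomputable def shadowStep (ν : Measure ℝ) (r : ℝ) (n : ℕ) (Φ : (ℕ → ℝ) → ℝ) (m : ℕ) :
    (ℕ → ℝ) → ℝ → ℝ :=
  stepSup r (n - (m + 1)) (shadowValue ν r n Φ m)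

variable {ν : Measure ℝ} {r : ℝ} {n : ℕ} {Φ : (ℕ → ℝ) → ℝ}

theorem shadowValue_succ (m : ℕ) (z : ℕ → ℝ) :
    shadowValue ν r n Φ (m + 1) z = fun η => ∫ g, shadowStep ν r n Φ m z (η + g) ∂ν :=
  rfl

/-- The shadow value averaged over a smooth distribution of the relative position. -/
noncomputable def smoothValue (ν : Measure ℝ) (h : ℝ) (n : ℕ) (Φ : (ℕ → ℝ) → ℝ) (m : ℕ)
    (z : ℕ → ℝ) : ℝ :=
  smoothMean h (shadowValue ν (3 * h / 2) n Φ m z) 0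

theorem smoothValue_zero (h : ℝ) (z : ℕ → ℝ) : smoothValue ν h n Φ 0 z = Φ z :=
  smoothMean_const _ _ _

variable [IsProbabilityMeasure ν]

theorem continuous_shadowValue (hr : 0 ≤ r) (hΦ : Continuous Φ) (h01 : ∀ z, Φ z ∈ Icc (0 : ℝ) 1)
    (m : ℕ) :
    (Continuous fun q : (ℕ → ℝ) × ℝ => shadowValue ν r n Φ m q.1 q.2) ∧
      ∀ z η, shadowValue ν r n Φ m z η ∈ Icc (0 : ℝ) 1 := by
  induction m with
  | zero => exact ⟨hΦ.comp continuous_fst, fun z _ => h01 z⟩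
  | succ m ih =>
    obtain ⟨hc, hb⟩ := ih
    have hT := continuous_stepSup r (n - (m + 1)) hc
    have hTb : ∀ z y, stepSup r (n - (m + 1)) (shadowValue ν r n Φ m) z y ∈ Icc (0 : ℝ) 1 := by
      intro z y
      obtain ⟨e, -, he⟩ := exists_stepSup_eq hr (n - (m + 1)) hc z y
      rw [he]
      exact hb _ _
    constructor
    · refine continuous_of_dominated (F := fun (q : (ℕ → ℝ) × ℝ) g =>
        stepSup r (n - (m + 1)) (shadowValue ν r n Φ m) q.1 (q.2 + g)) (bound := fun _ => 1)
        (fun q => ?_) (fun q => ?_) (integrable_const _) (.of_forall fun g => ?_)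
      · exact (hT.comp (by fun_prop : Continuous fun g : ℝ => (q.1, q.2 + g))).aestronglyMeasurable
      · refine .of_forall fun g => ?_
        rw [Real.norm_eq_abs, abs_of_nonneg (hTb _ _).1]
        exact (hTb _ _).2
      · exact hT.comp (by fun_prop : Continuous fun q : (ℕ → ℝ) × ℝ => (q.1, q.2 + g))
    · intro z η
      constructor
      · exact integral_nonneg fun g => (hTb _ _).1
      · refine (integral_mono_of_nonneg (.of_forall fun g => (hTb _ _).1) (integrable_const 1)
          (.of_forall fun g => (hTb _ _).2)).trans ?_
        simp

theorem continuous_shadowStep (hr : 0 ≤ r) (hΦ : Continuous Φ) (h01 : ∀ z, Φ z ∈ Icc (0 : ℝ) 1)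
    (m : ℕ) : Continuous fun q : (ℕ → ℝ) × ℝ => shadowStep ν r n Φ m q.1 q.2 :=
  continuous_stepSup _ _ (continuous_shadowValue hr hΦ h01 m).1

theorem shadowStep_mem_Icc (hr : 0 ≤ r) (hΦ : Continuous Φ) (h01 : ∀ z, Φ z ∈ Icc (0 : ℝ) 1)
    (m : ℕ) (z : ℕ → ℝ) (y : ℝ) : shadowStep ν r n Φ m z y ∈ Icc (0 : ℝ) 1 := by
  obtain ⟨hc, hb⟩ := continuous_shadowValue (ν := ν) (n := n) hr hΦ h01 m
  obtain ⟨e, -, he⟩ := exists_stepSup_eq hr (n - (m + 1)) hc z y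
  rw [shadowStep, he]
  exact hb _ _

/-- For every `|t| ≤ 3h/2`, displacement `e = t` is allowed at shadow position `y + t` and leaves
exactly the path increment `y`. Averaging over `t` gives the claim, since the kernel charges no
other `t`. -/
theorem smoothValue_update_le {h : ℝ} (hh : 0 ≤ h) (hΦ : Continuous Φ)
    (h01 : ∀ z, Φ z ∈ Icc (0 : ℝ) 1) (m : ℕ) (z : ℕ → ℝ) (y : ℝ) :
    smoothValue ν h n Φ m (update z (n - (m + 1)) y) ≤
      smoothMean h (shadowStep ν (3 * h / 2) n Φ m z) y := by
  have hr : 0 ≤ 3 * h / 2 := by linarith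
  have hc := (continuous_shadowValue (ν := ν) (n := n) hr hΦ h01 m).1
  have hT := continuous_shadowStep (ν := ν) (n := n) hr hΦ h01 m
  rw [← add_zero y, ← smoothMean_comp_add, add_zero]
  refine smoothMean_mono hh ?_ ?_ fun t ht => ?_
  · exact hc.comp (by fun_prop : Continuous fun t : ℝ => (update z (n - (m + 1)) y, t))
  · exact hT.comp (by fun_prop : Continuous fun t : ℝ => (z, y + t))
  · have := le_stepSup (n - (m + 1)) hc z (y + t) (abs_le.1 ht)
    rwa [add_sub_cancel_right] at this

/-- Smoothing commutes with the Gaussian average that defines the next value, so the recursion for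
the smoothed value closes with no further loss. -/
theorem integral_smoothMean_shadowStep {h : ℝ} (hh : 0 ≤ h) (hΦ : Continuous Φ)
    (h01 : ∀ z, Φ z ∈ Icc (0 : ℝ) 1) (m : ℕ) (z : ℕ → ℝ) :
    ∫ g, smoothMean h (shadowStep ν (3 * h / 2) n Φ m z) g ∂ν = smoothValue ν h n Φ (m + 1) z := by
  have hr : 0 ≤ 3 * h / 2 := by linarith
  have hT := continuous_shadowStep (ν := ν) (n := n) hr hΦ h01 m
  rw [smoothValue, shadowValue_succ, smoothMean_integral_add hh
    (T := shadowStep ν (3 * h / 2) n Φ m z)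
    (hT.comp (by fun_prop : Continuous fun t : ℝ => (z, t)))
    (shadowStep_mem_Icc hr hΦ h01 m z)]
  simp

theorem continuous_smoothValue {h : ℝ} (hh : 0 ≤ h) (hΦ : Continuous Φ)
    (h01 : ∀ z, Φ z ∈ Icc (0 : ℝ) 1) (m : ℕ) : Continuous (smoothValue ν h n Φ m) := by
  have hc := (continuous_shadowValue (ν := ν) (n := n) (by linarith : 0 ≤ 3 * h / 2) hΦ h01 m).1
  exact (continuous_smoothMean_uncurry h hc).comp
    (by fun_prop : Continuous fun z : ℕ → ℝ => (z, (0 : ℝ)))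

theorem smoothValue_mem_Icc {h : ℝ} (hh : 0 ≤ h) (hΦ : Continuous Φ)
    (h01 : ∀ z, Φ z ∈ Icc (0 : ℝ) 1) (m : ℕ) (z : ℕ → ℝ) :
    smoothValue ν h n Φ m z ∈ Icc (0 : ℝ) 1 := by
  have hc := continuous_shadowValue (ν := ν) (n := n) (by linarith : 0 ≤ 3 * h / 2) hΦ h01 m
  exact smoothMean_mem_Icc hh (hc.1.comp (by fun_prop : Continuous fun t : ℝ => (z, t)))
    (hc.2 z) 0

/-- The integral of `U` over the last `m` of `n` coordinates. -/
noncomputable def tailIntegral (ν : Measure ℝ) (n : ℕ) (U : (ℕ → ℝ) → ENNReal) :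
    ℕ → (ℕ → ℝ) → ENNReal
  | 0 => U
  | m + 1 => fun v => ∫⁻ g, tailIntegral ν n U m (update v (n - (m + 1)) g) ∂ν

theorem measurable_update_prod (k : ℕ) :
    Measurable fun q : (ℕ → ℝ) × ℝ => update q.1 k q.2 :=
  (continuous_fst.update k continuous_snd).measurable

theorem measurable_tailIntegral {U : (ℕ → ℝ) → ENNReal} (hU : Measurable U) (m : ℕ) :
    Measurable (tailIntegral ν n U m) := by
  induction m with
  | zero => exact hU
  | succ m ih => exact (ih.comp (measurable_update_prod _)).lintegral_prod_right'

theorem sum_range_update_of_le {j k : ℕ} (hjk : j ≤ k) (z : ℕ → ℝ) (y : ℝ) :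
    ∑ i ∈ Finset.range j, update z k y i = ∑ i ∈ Finset.range j, z i := by
  refine Finset.sum_congr rfl fun i hi => ?_
  rw [update_of_ne]
  have := Finset.mem_range.1 hi
  omega

theorem sum_range_succ_update (k : ℕ) (z : ℕ → ℝ) (y : ℝ) :
    ∑ i ∈ Finset.range (k + 1), update z k y i = ∑ i ∈ Finset.range k, z i + y := by
  rw [Finset.sum_range_succ, sum_range_update_of_le le_rfl, update_self]

/-- A path within distance `r` of its shadow is within distance `2r` of the shadow started at
the origin. -/
theorem ofReal_shadowValue_le (hr : 0 ≤ r) (hΦ : Continuous Φ) (h01 : ∀ z, Φ z ∈ Icc (0 : ℝ) 1)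
    {U : (ℕ → ℝ) → ENNReal}
    (hU : ∀ z v : ℕ → ℝ, (∀ j ≤ n, |∑ i ∈ Finset.range j, z i - ∑ i ∈ Finset.range j, v i| ≤ 2 * r)
      → ENNReal.ofReal (Φ z) ≤ U v) {η₀ : ℝ} (hη₀ : |η₀| ≤ r)
    (m : ℕ) (hm : m ≤ n) (z v : ℕ → ℝ) (η : ℝ)
    (hzv : ∀ j ≤ n - m, |∑ i ∈ Finset.range j, z i - ∑ i ∈ Finset.range j, v i| ≤ 2 * r)
    (hlast : ∑ i ∈ Finset.range (n - m), v i = ∑ i ∈ Finset.range (n - m), z i + η - η₀) :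
    ENNReal.ofReal (shadowValue ν r n Φ m z η) ≤ tailIntegral ν n U m v := by
  induction m generalizing z v η with
  | zero => exact hU z v hzv
  | succ m ih =>
    have hc := (continuous_shadowValue (ν := ν) (n := n) hr hΦ h01 m).1
    have hT := continuous_shadowStep (ν := ν) (n := n) hr hΦ h01 m
    have hTb := shadowStep_mem_Icc (ν := ν) (n := n) hr hΦ h01 m
    have hk : n - m = n - (m + 1) + 1 := by omega
    rw [shadowValue_succ, ofReal_integral_eq_lintegral_ofReal, tailIntegral]
    · refine lintegral_mono fun g => ?_
      obtain ⟨e, he, heq⟩ := exists_stepSup_eq hr (n - (m + 1)) hc z (η + g)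
      rw [shadowStep, heq]
      have he' : |e| ≤ r := abs_le.2 he
      refine ih (by omega) _ _ _ (fun j hj => ?_) ?_
      · rcases Nat.lt_or_ge (n - (m + 1)) j with hj' | hj'
        -- After the step the shadow from the origin and the path differ by `e - η₀`: the new
        -- relative position minus the initial one, each at most `r` in size.
        · obtain rfl : j = n - (m + 1) + 1 := by omega
          rw [sum_range_succ_update, sum_range_succ_update, hlast]
          rw [abs_le] at he' hη₀ ⊢
          constructor <;> linarith [he'.1, he'.2, hη₀.1, hη₀.2]
        · rw [sum_range_update_of_le hj', sum_range_update_of_le hj']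
          exact hzv j hj'
      · rw [hk, sum_range_succ_update, sum_range_succ_update, hlast]
        ring
    · refine Integrable.of_bound (C := 1) ?_ (.of_forall fun g => ?_)
      · exact (hT.comp (by fun_prop : Continuous fun g : ℝ => (z, η + g))).aestronglyMeasurable
      · rw [Real.norm_eq_abs, abs_of_nonneg (hTb _ _).1]
        exact (hTb _ _).2
    · exact .of_forall fun g => (hTb _ _).1

theorem ofReal_smoothValue_le {h : ℝ} (hh : 0 ≤ h) (hΦ : Continuous Φ)
    (h01 : ∀ z, Φ z ∈ Icc (0 : ℝ) 1) {U : (ℕ → ℝ) → ENNReal}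
    (hU : ∀ z v : ℕ → ℝ, (∀ j ≤ n, |∑ i ∈ Finset.range j, z i - ∑ i ∈ Finset.range j, v i| ≤ 3 * h)
      → ENNReal.ofReal (Φ z) ≤ U v) :
    ENNReal.ofReal (smoothValue ν h n Φ n 0) ≤ tailIntegral ν n U n 0 := by
  have hr : 0 ≤ 3 * h / 2 := by linarith
  by_cases htop : tailIntegral ν n U n 0 = ⊤
  · rw [htop]
    exact le_top
  have hc := continuous_shadowValue (ν := ν) (n := n) hr hΦ h01 n
  rw [ENNReal.ofReal_le_iff_le_toReal htop, smoothValue,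
    ← smoothMean_const h (tailIntegral ν n U n 0).toReal 0]
  refine smoothMean_mono hh (hc.1.comp (by fun_prop : Continuous fun t : ℝ => ((0 : ℕ → ℝ), t)))
    continuous_const fun t ht => ?_
  rw [← ENNReal.ofReal_le_iff_le_toReal htop]
  refine ofReal_shadowValue_le hr hΦ h01 (fun z v hzv => hU z v fun j hj => ?_) ht n le_rfl 0 0 t
    (by simp; linarith) (by simp)
  linarith [hzv j hj]

end BackwardRecursion

/-! ### Iterated integrals against independent sequences -/

section IndependentIncrements

open Function

variable {Ω' : Type*} [MeasurableSpace Ω'] {P : Measure Ω'}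

/-- The first `k` terms of a sequence, followed by zeros. -/
def truncateSeq (k : ℕ) (x : ℕ → ℝ) : ℕ → ℝ := fun j => if j < k then x j else 0

theorem truncateSeq_zero (x : ℕ → ℝ) : truncateSeq 0 x = 0 := by
  ext j
  simp [truncateSeq]

theorem truncateSeq_succ (k : ℕ) (x : ℕ → ℝ) :
    truncateSeq (k + 1) x = update (truncateSeq k x) k (x k) := by
  ext j
  rcases eq_or_ne j k with rfl | hj
  · simp [truncateSeq]
  · rw [update_of_ne hj]
    simp only [truncateSeq]
    congr 1
    simp only [eq_iff_iff]
    omega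

theorem aemeasurable_truncateSeq {D : ℕ → Ω' → ℝ} (hm : ∀ i, AEMeasurable (D i) P) (k : ℕ) :
    AEMeasurable (fun ω => truncateSeq k fun j => D j ω) P := by
  rw [aemeasurable_pi_iff]
  intro j
  simp only [truncateSeq]
  split_ifs
  · exact hm j
  · exact aemeasurable_const

/-- The terms before `k` are independent of `D k`, so Tonelli integrates the latter against its own
law. Padding by zeros keeps every stage in the same sequence space. -/
theorem lintegral_truncateSeq_succ [IsProbabilityMeasure P] {D : ℕ → Ω' → ℝ} {ν : ℕ → Measure ℝ}
    (hD : iIndepFun D P) (hlaw : ∀ k, HasLaw (D k) (ν k) P) {U : (ℕ → ℝ) → ENNReal}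
    (hU : Measurable U) (k : ℕ) :
    ∫⁻ ω, U (truncateSeq (k + 1) fun j => D j ω) ∂P =
      ∫⁻ ω, ∫⁻ g, U (update (truncateSeq k fun j => D j ω) k g) ∂(ν k) ∂P := by
  have hm : ∀ i, AEMeasurable (D i) P := fun i => (hlaw i).aemeasurable
  have : IsProbabilityMeasure (ν k) := (hlaw k).map_eq ▸ Measure.isProbabilityMeasure_map (hm k)
  have hpad := aemeasurable_truncateSeq hm k
  have hind : IndepFun (fun ω => truncateSeq k fun j => D j ω) (D k) P := by
    have h := hD.indepFun_finset₀ (Finset.range k) {k} (by simp) hm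
    have hφ : Measurable fun (u : Finset.range k → ℝ) (j : ℕ) =>
        if hj : j ∈ Finset.range k then u ⟨j, hj⟩ else 0 := by
      rw [measurable_pi_iff]
      intro j
      by_cases hj : j ∈ Finset.range k
      · simp only [hj, dite_true]
        fun_prop
      · simp only [hj, dite_false]
        fun_prop
    have hψ : Measurable fun u : ({k} : Finset ℕ) → ℝ => u ⟨k, by simp⟩ := measurable_pi_apply _
    have h' := h.comp hφ hψ
    convert h' using 1
    · ext ω j
      simp [truncateSeq]
    · rfl
  have hprod := (indepFun_iff_map_prod_eq_prod_map_map hpad (hm k)).1 hind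
  have hUu : Measurable fun q : (ℕ → ℝ) × ℝ => U (update q.1 k q.2) :=
    hU.comp (measurable_update_prod k)
  calc ∫⁻ ω, U (truncateSeq (k + 1) fun j => D j ω) ∂P
      = ∫⁻ q, U (update q.1 k q.2) ∂(P.map fun ω => (truncateSeq k fun j => D j ω, D k ω)) := by
        rw [lintegral_map' hUu.aemeasurable (hpad.prodMk (hm k))]
        simp only [truncateSeq_succ]
    _ = ∫⁻ v, ∫⁻ g, U (update v k g) ∂(ν k) ∂(P.map fun ω => truncateSeq k fun j => D j ω) := by
        rw [hprod, (hlaw k).map_eq, lintegral_prod _ hUu.aemeasurable]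
    _ = _ := lintegral_map' hUu.lintegral_prod_right'.aemeasurable hpad

/-- Only the laws before `n` are prescribed: in the application the time grid stops at `1`, and
later increments are degenerate. -/
theorem lintegral_truncateSeq_eq_tailIntegral [IsProbabilityMeasure P] {D : ℕ → Ω' → ℝ} {ν : Measure ℝ}
    [IsProbabilityMeasure ν] (hD : iIndepFun D P) {n : ℕ} {ν' : ℕ → Measure ℝ}
    (hlaw : ∀ k, HasLaw (D k) (ν' k) P) (hν : ∀ k < n, ν' k = ν)
    {U : (ℕ → ℝ) → ENNReal} (hU : Measurable U) :
    ∫⁻ ω, U (truncateSeq n fun j => D j ω) ∂P = tailIntegral ν n U n 0 := by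
  have key : ∀ m ≤ n, ∫⁻ ω, U (truncateSeq n fun j => D j ω) ∂P =
      ∫⁻ ω, tailIntegral ν n U m (truncateSeq (n - m) fun j => D j ω) ∂P := by
    intro m hm
    induction m with
    | zero => rfl
    | succ m ih =>
      rw [ih (by omega), show n - m = n - (m + 1) + 1 by omega,
        lintegral_truncateSeq_succ hD hlaw (measurable_tailIntegral hU m),
        hν _ (by omega)]
      rfl
  rw [key n le_rfl]
  simp [truncateSeq_zero]

/-- The supermartingale inequality, in a form that needs no filtration. -/
theorem lintegral_truncateSeq_le [IsProbabilityMeasure P] {D : ℕ → Ω' → ℝ} {ν : ℕ → Measure ℝ} (hD : iIndepFun D P)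
    (hlaw : ∀ k, HasLaw (D k) (ν k) P) {U : ℕ → (ℕ → ℝ) → ENNReal} (hU : ∀ k, Measurable (U k))
    {N : ℕ} (hstep : ∀ k < N, ∀ v, ∫⁻ g, U (k + 1) (update v k g) ∂(ν k) ≤ U k v) :
    ∫⁻ ω, U N (truncateSeq N fun j => D j ω) ∂P ≤ U 0 0 := by
  have key : ∀ k ≤ N, ∫⁻ ω, U k (truncateSeq k fun j => D j ω) ∂P ≤ U 0 0 := by
    intro k hk
    induction k with
    | zero => simp [truncateSeq_zero]
    | succ k ih =>
      rw [lintegral_truncateSeq_succ hD hlaw (hU _)]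
      exact (lintegral_mono fun ω => hstep k (by omega) _).trans (ih (by omega))
  exact key N le_rfl

end IndependentIncrements

/-! ### Broken lines and partial sums -/

section BrokenLine

/-- A broken line interpolates between consecutive partial sums. -/
theorem exists_brokenLine_eq {n : ℕ} (hn : 1 ≤ n) (t : I) :
    ∃ k < n, ∃ s ∈ Icc (0 : ℝ) 1, (n : ℝ) * t = k + s ∧ ∀ z : ℕ → ℝ,
      brokenLine (fun i : Fin n => z i) t =
        ∑ i ∈ Finset.range k, z i + s * z k := by
  have hn' : (1 : ℝ) ≤ n := by exact_mod_cast hn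
  have ht0 := t.2.1
  have ht1 := t.2.2
  obtain ⟨k, hk, h₁, h₂⟩ : ∃ k < n, ((k : ℕ) : ℝ) ≤ n * (t : ℝ) ∧ (n : ℝ) * (t : ℝ) ≤ k + 1 := by
    rcases eq_or_lt_of_le ht1 with h | h
    · refine ⟨n - 1, by omega, ?_, ?_⟩
      · rw [h, Nat.cast_sub hn]
        norm_num
      · rw [h, Nat.cast_sub hn]
        norm_num
    · refine ⟨⌊(n : ℝ) * t⌋₊, ?_, Nat.floor_le (by positivity), (Nat.lt_floor_add_one _).le⟩
      rw [Nat.floor_lt (by positivity)]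
      nlinarith
  refine ⟨k, hk, n * (t : ℝ) - k, ⟨by linarith, by linarith⟩, by ring, fun z => ?_⟩
  rw [brokenLine_apply _ ⟨k, hk⟩ t h₁ h₂]
  congr 1
  rw [← Nat.Iio_eq_range, ← Fin.map_valEmbedding_Iio ⟨k, hk⟩, Finset.sum_map]
  rfl

theorem norm_brokenLine_sub_le {n : ℕ} (hn : 1 ≤ n) {ρ : ℝ} (z v : ℕ → ℝ)
    (h : ∀ j ≤ n, |∑ i ∈ Finset.range j, z i - ∑ i ∈ Finset.range j, v i| ≤ ρ) :
    ‖brokenLine (fun i : Fin n => z i) - brokenLine (fun i : Fin n => v i)‖ ≤ ρ := by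
  have hρ : 0 ≤ ρ := (abs_nonneg _).trans (h 0 (by omega))
  rw [ContinuousMap.norm_le _ hρ]
  intro t
  obtain ⟨k, hk, s, hs, -, hz⟩ := exists_brokenLine_eq hn t
  rw [ContinuousMap.sub_apply, hz, hz, Real.norm_eq_abs]
  have h0 := abs_le.1 (h k hk.le)
  have h1 := abs_le.1 (h (k + 1) hk)
  rw [Finset.sum_range_succ, Finset.sum_range_succ] at h1
  rw [abs_le]
  constructor <;> nlinarith [hs.1, hs.2, h0.1, h0.2, h1.1, h1.2]

theorem continuous_brokenLine (n : ℕ) :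
    Continuous fun z : Fin n → ℝ => brokenLine z := by
  have : (fun z : Fin n → ℝ => brokenLine z) = fun z => ∑ i : Fin n, z i •
      (⟨fun t : I => max 0 (min 1 ((n : ℝ) * (t : ℝ) - (i : ℕ))), by fun_prop⟩ : C(I, ℝ)) := by
    ext z t
    simp [brokenLine]
  rw [this]
  fun_prop

end BrokenLine

/-! ### Exponential maximal inequality for Gaussian sums -/

section MaximalInequality

open Function Real

theorem gaussianReal_cosh (v : NNReal) (c s : ℝ) :
    Integrable (fun g => cosh (c * (s + g))) (gaussianReal 0 v) ∧
      ∫ g, cosh (c * (s + g)) ∂(gaussianReal 0 v) = cosh (c * s) * exp (c ^ 2 * v / 2) := by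
  have hi := fun t : ℝ => integrable_exp_mul_gaussianReal (μ := 0) (v := v) t
  have hmgf : ∀ t : ℝ, ∫ g, exp (t * g) ∂(gaussianReal 0 v) = exp (v * t ^ 2 / 2) := by
    intro t
    have := mgf_gaussianReal (p := gaussianReal 0 v) (X := id) (μ := 0) (v := v) (by simp) t
    simpa [mgf] using this
  have e : (fun g => cosh (c * (s + g))) = fun g =>
      exp (c * s) / 2 * exp (c * g) + exp (-(c * s)) / 2 * exp (-c * g) := by
    ext g
    rw [cosh_eq, mul_add, neg_add, exp_add, exp_add]
    ring_nf
  rw [e]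
  refine ⟨((hi c).const_mul _).add ((hi (-c)).const_mul _), ?_⟩
  rw [integral_add ((hi c).const_mul _) ((hi (-c)).const_mul _), integral_const_mul,
    integral_const_mul, hmgf, hmgf, cosh_eq]
  ring_nf

variable {Ω' : Type*} [MeasurableSpace Ω'] {P : Measure Ω'} [IsProbabilityMeasure P]

/-- The exponential maximal inequality for partial sums of centred Gaussian variables. -/
theorem measure_max_sum_gt_le {D : ℕ → Ω' → ℝ} {ν : ℕ → Measure ℝ} (hD : iIndepFun D P)
    (hlaw : ∀ k, HasLaw (D k) (ν k) P) {N : ℕ} {v : NNReal}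
    (hν : ∀ k < N, ν k = gaussianReal 0 v) {a : ℝ} (ha : 0 < a) (c : ℝ) :
    P {ω | ∃ j ≤ N, a < |∑ i ∈ Finset.range j, D i ω|} ≤
      ENNReal.ofReal (exp (c ^ 2 * (N * v) / 2) / cosh (c * a)) := by
  classical
  -- `Q` is a supermartingale that freezes at `1` once the level has been passed. Before that it
  -- follows `R`, which has constant Gaussian average and, when the level is first exceeded, is at
  -- least `1`.
  let flag : ℕ → Set (ℕ → ℝ) := fun k => {z | ∃ j ≤ k, a < |∑ i ∈ Finset.range j, z i|}
  let R : ℕ → (ℕ → ℝ) → ℝ := fun k z =>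
    cosh (c * ∑ i ∈ Finset.range k, z i) * (exp (c ^ 2 * ((N - k : ℝ) * v) / 2) / cosh (c * a))
  let Q : ℕ → (ℕ → ℝ) → ENNReal := fun k z => if z ∈ flag k then 1 else ENNReal.ofReal (R k z)
  have hflag : ∀ k, MeasurableSet (flag k) := by
    intro k
    have : flag k = ⋃ j ∈ Finset.range (k + 1), {z | a < |∑ i ∈ Finset.range j, z i|} := by
      ext z
      simp [flag]
    rw [this]
    refine Finset.measurableSet_biUnion _ fun j _ => ?_
    exact measurableSet_lt measurable_const (by fun_prop)
  have hQ : ∀ k, Measurable (Q k) := by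
    intro k
    refine Measurable.ite (hflag k) measurable_const (Measurable.ennreal_ofReal ?_)
    exact Continuous.measurable (by fun_prop)
  have hstep : ∀ k < N, ∀ z, ∫⁻ g, Q (k + 1) (update z k g) ∂(ν k) ≤ Q k z := by
    intro k hk z
    rw [hν k hk]
    by_cases hz : z ∈ flag k
    · have h1 : ∀ g, Q (k + 1) (update z k g) = 1 := by
        intro g
        refine if_pos ?_
        obtain ⟨j, hj, hja⟩ := hz
        exact ⟨j, by omega, by rwa [sum_range_update_of_le hj]⟩
      simp only [h1, Q, if_pos hz]
      simp
    · have h1 : ∀ g, Q (k + 1) (update z k g) ≤ ENNReal.ofReal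
          (cosh (c * (∑ i ∈ Finset.range k, z i + g)) *
            (exp (c ^ 2 * ((N - (k + 1 : ℕ) : ℝ) * v) / 2) / cosh (c * a))) := by
        intro g
        simp only [Q, R, sum_range_succ_update]
        split_ifs with hg
        · rw [← ENNReal.ofReal_one]
          refine ENNReal.ofReal_le_ofReal ?_
          obtain ⟨j, hj, hja⟩ := hg
          rcases Nat.lt_or_ge k j with hkj | hkj
          · obtain rfl : j = k + 1 := by omega
            rw [sum_range_succ_update] at hja
            have hexp : 1 ≤ exp (c ^ 2 * ((N - (k + 1 : ℕ) : ℝ) * v) / 2) := by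
              rw [one_le_exp_iff]
              have : ((k + 1 : ℕ) : ℝ) ≤ N := by exact_mod_cast hk
              have := mul_nonneg (sub_nonneg.2 this) v.2
              positivity
            have hcosh : cosh (c * a) ≤ cosh (c * (∑ i ∈ Finset.range k, z i + g)) := by
              rw [cosh_le_cosh, abs_mul, abs_mul, abs_of_pos ha]
              gcongr
            rw [← mul_div_assoc, one_le_div (cosh_pos _)]
            nlinarith [cosh_pos (c * (∑ i ∈ Finset.range k, z i + g))]
          · rw [sum_range_update_of_le hkj] at hja
            exact absurd (show z ∈ flag k from ⟨j, hkj, hja⟩) hz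
        · exact le_rfl
      obtain ⟨hint, heq⟩ := gaussianReal_cosh v c (∑ i ∈ Finset.range k, z i)
      refine (lintegral_mono h1).trans ?_
      rw [← ofReal_integral_eq_lintegral_ofReal (hint.mul_const _)
        (.of_forall fun g => by have := cosh_pos (c * a); positivity), integral_mul_const, heq]
      simp only [Q, if_neg hz, R]
      refine ENNReal.ofReal_le_ofReal (le_of_eq ?_)
      rw [mul_assoc, ← mul_div_assoc, ← exp_add]
      congr 3
      push_cast
      ring
  have h0 : Q 0 0 = ENNReal.ofReal (exp (c ^ 2 * (N * v) / 2) / cosh (c * a)) := by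
    have : (0 : ℕ → ℝ) ∉ flag 0 := by
      rintro ⟨j, hj, hja⟩
      simp at hja
      linarith
    simp [Q, if_neg this, R]
  rw [← h0]
  refine le_trans ?_ (lintegral_truncateSeq_le hD hlaw hQ hstep)
  have hm := (hQ N).comp_aemeasurable (aemeasurable_truncateSeq (fun i => (hlaw i).aemeasurable) N)
  refine le_trans (measure_mono (t := {ω | 1 ≤ Q N (truncateSeq N fun j => D j ω)}) ?_)
    (by simpa using mul_meas_ge_le_lintegral₀ hm 1)
  rintro ω ⟨j, hj, hja⟩
  have hmem : (truncateSeq N fun j => D j ω) ∈ flag N := by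
    refine ⟨j, hj, ?_⟩
    convert hja using 3 with i hi
    have := Finset.mem_range.1 hi
    simp only [truncateSeq]
    rw [if_pos (by omega)]
  have hQN : Q N (truncateSeq N fun j => D j ω) = 1 := if_pos hmem
  exact hQN.ge

theorem measure_max_sum_gt_le_exp {D : ℕ → Ω' → ℝ} {ν : ℕ → Measure ℝ} (hD : iIndepFun D P)
    (hlaw : ∀ k, HasLaw (D k) (ν k) P) {N : ℕ} {v : NNReal}
    (hν : ∀ k < N, ν k = gaussianReal 0 v) {a τ : ℝ} (ha : 0 < a) (hτ : N * (v : ℝ) = τ)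
    (hτ0 : 0 < τ) :
    P {ω | ∃ j ≤ N, a < |∑ i ∈ Finset.range j, D i ω|} ≤
      ENNReal.ofReal (2 * exp (-(a ^ 2 / (2 * τ)))) := by
  -- The choice `c = a / τ` minimizes the exponent `c² τ / 2 - c a`; the factor `2` comes from `cosh
  -- x ≥ exp x / 2`.
  refine (measure_max_sum_gt_le hD hlaw hν ha (a / τ)).trans
    (ENNReal.ofReal_le_ofReal ?_)
  rw [hτ, div_le_iff₀ (cosh_pos _)]
  have h1 : exp (a / τ * a) / 2 ≤ cosh (a / τ * a) := by
    rw [cosh_eq]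
    linarith [exp_pos (-(a / τ * a))]
  calc exp ((a / τ) ^ 2 * τ / 2) = 2 * exp (-(a ^ 2 / (2 * τ))) * (exp (a / τ * a) / 2) := by
        rw [show ∀ x y : ℝ, 2 * x * (y / 2) = x * y by intros; ring, ← exp_add]
        congr 1
        field_simp
        ring
    _ ≤ _ := by gcongr

end MaximalInequality

/-! ### Wiener paths and their broken lines -/

section Wiener

open Function Real Filter Topology

variable {Ω' : Type*} [MeasurableSpace Ω'] {P : Measure Ω'} {B : Ω' → C(I, ℝ)}

/-- The increments of a path along a sequence of times. -/
def pathIncrement (t : ℕ → I) (b : C(I, ℝ)) (j : ℕ) : ℝ := b (t (j + 1)) - b (t j)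

theorem sum_pathIncrement (t : ℕ → I) (b : C(I, ℝ)) (j : ℕ) :
    ∑ i ∈ Finset.range j, pathIncrement t b i = b (t j) - b (t 0) :=
  Finset.sum_range_sub (fun i => b (t i)) j

/-- The times `s + j d`, cut off at the ends of the unit interval. -/
noncomputable def arithTimes (s d : ℝ) (j : ℕ) : I := projIcc 0 1 zero_le_one (s + j * d)

theorem monotone_arithTimes (s : ℝ) {d : ℝ} (hd : 0 ≤ d) : Monotone (arithTimes s d) := by
  intro i j hij
  refine monotone_projIcc _ ?_
  have : (i : ℝ) ≤ j := by exact_mod_cast hij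
  nlinarith

theorem coe_arithTimes {s d : ℝ} {j : ℕ} (h0 : 0 ≤ s + j * d) (h1 : s + j * d ≤ 1) :
    (arithTimes s d j : ℝ) = s + j * d := by
  rw [arithTimes, projIcc_of_mem _ ⟨h0, h1⟩]

theorem IsWienerProcess.iIndepFun_pathIncrement (hB : IsWienerProcess B P) {t : ℕ → I}
    (ht : Monotone t) : iIndepFun (fun j ω => pathIncrement t (B ω) j) P :=
  hB.indepIncrements.nat ht

theorem IsWienerProcess.hasLaw_pathIncrement (hB : IsWienerProcess B P) {t : ℕ → I}
    (ht : Monotone t) (j : ℕ) : HasLaw (fun ω => pathIncrement t (B ω) j)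
      (gaussianReal 0 (Real.toNNReal ((t (j + 1) : ℝ) - (t j : ℝ)))) P :=
  hB.increments _ _ (ht j.le_succ)

theorem arithTimes_succ_sub {s d : ℝ} (hs : 0 ≤ s) (hd : 0 ≤ d) {N : ℕ} (h1 : s + N * d ≤ 1)
    {j : ℕ} (hj : j < N) :
    (arithTimes s d (j + 1) : ℝ) - (arithTimes s d j : ℝ) = d := by
  have hjN : ((j : ℝ) + 1) ≤ N := by exact_mod_cast hj
  rw [coe_arithTimes (by positivity), coe_arithTimes (by positivity)]
  · push_cast
    ring
  · nlinarith
  · push_cast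
    nlinarith

/-- The maximal inequality is uniform over the dyadic grids of `[s, s + τ]`, because the total
variance is `τ` on each; the grids are nested, and continuity of paths passes to all times. Here
`arithTimes s 0 0` is just `s` as a point of the unit interval. -/
theorem IsWienerProcess.measure_osc_gt_le [IsProbabilityMeasure P]
    (hB : IsWienerProcess B P) {s τ a : ℝ} (hs : 0 ≤ s)
    (hτ : 0 < τ) (h1 : s + τ ≤ 1) (ha : 0 < a) :
    P {ω | ∃ t : I, s ≤ t ∧ (t : ℝ) ≤ s + τ ∧ a < |B ω t - B ω (arithTimes s 0 0)|} ≤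
      ENNReal.ofReal (2 * exp (-(a ^ 2 / (2 * τ)))) := by
  let d : ℕ → ℝ := fun i => τ / 2 ^ i
  have hd : ∀ i, 0 < d i := fun i => by positivity
  have hNd : ∀ i, ((2 ^ i : ℕ) : ℝ) * d i = τ := fun i => by
    simp only [d]
    push_cast
    field_simp
  let E : ℕ → Set Ω' := fun i =>
    {ω | ∃ j ≤ 2 ^ i, a < |B ω (arithTimes s (d i) j) - B ω (arithTimes s 0 0)|}
  have hstart : ∀ d', arithTimes s d' 0 = arithTimes s 0 0 := fun d' => by simp [arithTimes]
  have hE : ∀ i, P (E i) ≤ ENNReal.ofReal (2 * exp (-(a ^ 2 / (2 * τ)))) := by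
    intro i
    have ht := monotone_arithTimes s (hd i).le
    have := measure_max_sum_gt_le_exp (N := 2 ^ i) (v := (d i).toNNReal) (τ := τ)
      (hB.iIndepFun_pathIncrement ht) (hB.hasLaw_pathIncrement ht)
      (fun k hk => by rw [arithTimes_succ_sub hs (hd i).le (by rw [hNd]; exact h1) hk]) ha
      (by rw [Real.coe_toNNReal _ (hd i).le, hNd]) hτ
    simpa only [sum_pathIncrement, hstart (d i)] using this
  have hmono : Monotone E := by
    refine monotone_nat_of_le_succ fun i => ?_
    rintro ω ⟨j, hj, hja⟩
    refine ⟨2 * j, by rw [pow_succ]; omega, ?_⟩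
    convert hja using 4
    simp only [arithTimes, d]
    congr 1
    push_cast
    field_simp
    ring
  refine le_trans (measure_mono (t := ⋃ i, E i) ?_) ?_
  · rintro ω ⟨t, hst, htu, hta⟩
    have hx0 : 0 ≤ ((t : ℝ) - s) / τ := div_nonneg (by linarith) hτ.le
    -- Dyadic points to the left of `t` converge to `t`, and the inequality defining the event is
    -- strict, hence survives at some level.
    have hlim : Tendsto (fun i : ℕ => arithTimes s (d i) ⌊((t : ℝ) - s) / τ * 2 ^ i⌋₊) atTop
        (𝓝 t) := by
      have h2 : Tendsto (fun i : ℕ => (2 : ℝ) ^ i) atTop atTop :=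
        tendsto_pow_atTop_atTop_of_one_lt (by norm_num)
      have h3 := ((tendsto_nat_floor_mul_div_atTop hx0).comp h2).mul_const τ |>.const_add s
      have h4 := (continuous_projIcc (h := (zero_le_one : (0 : ℝ) ≤ 1))).continuousAt.tendsto.comp h3
      have e : projIcc (0 : ℝ) 1 zero_le_one (s + ((t : ℝ) - s) / τ * τ) = t := by
        rw [div_mul_cancel₀ _ hτ.ne', add_sub_cancel]
        exact projIcc_val _ _
      rw [e] at h4
      refine h4.congr fun i => ?_
      simp only [comp_apply, arithTimes, d]
      congr 2
      ring
    have hev : ∀ᶠ i : ℕ in atTop,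
        a < |B ω (arithTimes s (d i) ⌊((t : ℝ) - s) / τ * 2 ^ i⌋₊) - B ω (arithTimes s 0 0)| := by
      have hc : Tendsto (fun u : I => |B ω u - B ω (arithTimes s 0 0)|) (𝓝 t)
          (𝓝 |B ω t - B ω (arithTimes s 0 0)|) := by
        exact Continuous.tendsto (by fun_prop) t
      exact (hc.comp hlim).eventually (lt_mem_nhds hta)
    obtain ⟨i, hi⟩ := hev.exists
    refine mem_iUnion.2 ⟨i, _, ?_, hi⟩
    refine Nat.floor_le_of_le ?_
    push_cast
    have : ((t : ℝ) - s) / τ ≤ 1 := by rw [div_le_one hτ]; linarith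
    have h2 : (0 : ℝ) < 2 ^ i := by positivity
    nlinarith
  · rw [hmono.measure_iUnion]
    exact iSup_le hE

/-- The broken line through the values of a Wiener process at the times `j / n`. -/
theorem IsWienerProcess.measure_norm_sub_brokenLine_gt_le [IsProbabilityMeasure P]
    (hB : IsWienerProcess B P) {n : ℕ}
    (hn : 1 ≤ n) {δ : ℝ} (hδ : 0 < δ) :
    P {ω | δ < ‖B ω - brokenLine (fun i : Fin n => pathIncrement (arithTimes 0 (1 / n)) (B ω) i)‖} ≤
      n * ENNReal.ofReal (2 * exp (-(δ ^ 2 * n / 8))) := by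
  have hn' : (0 : ℝ) < n := by exact_mod_cast hn
  let F : ℕ → Set Ω' := fun k => {ω | ∃ t : I, (k : ℝ) / n ≤ t ∧ (t : ℝ) ≤ (k : ℝ) / n + 1 / n ∧
    δ / 2 < |B ω t - B ω (arithTimes (k / n) 0 0)|}
  have hF : ∀ k ∈ Finset.range n, P (F k) ≤ ENNReal.ofReal (2 * exp (-(δ ^ 2 * n / 8))) := by
    intro k hk
    have hk' : (k : ℝ) + 1 ≤ n := by exact_mod_cast Finset.mem_range.1 hk
    have := hB.measure_osc_gt_le (s := k / n) (τ := 1 / n) (a := δ / 2) (by positivity)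
      (by positivity) (by rw [← add_div, div_le_one hn']; exact hk') (by positivity)
    refine this.trans (le_of_eq ?_)
    congr 4
    field_simp
    ring
  have hnull : P {ω | ¬ B ω 0 = 0} = 0 := hB.zero
  calc _ ≤ P ({ω | ¬ B ω 0 = 0} ∪ ⋃ k ∈ Finset.range n, F k) := by
        refine measure_mono fun ω hω => ?_
        by_contra hcon
        simp only [mem_union, not_or, mem_ofPred_eq, not_not, mem_iUnion, not_exists] at hcon
        obtain ⟨h0, hosc⟩ := hcon
        rw [mem_ofPred_eq] at hω
        refine not_le.2 hω ?_
        rw [ContinuousMap.norm_le _ hδ.le]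
        intro t
        obtain ⟨k, hk, u, hu, hnt, hz⟩ := exists_brokenLine_eq hn t
        have hk' : (k : ℝ) + 1 ≤ n := by exact_mod_cast hk
        have hFk := hosc k (Finset.mem_range.2 hk)
        simp only [F, mem_ofPred_eq, not_exists, not_and, not_lt] at hFk
        have ht : (t : ℝ) = (k : ℝ) / n + u / n := by
          field_simp
          linarith
        have e1 : arithTimes (k / n) 0 0 = arithTimes 0 (1 / n) k := by
          simp [arithTimes, div_eq_mul_inv]
        have e0 : arithTimes 0 (1 / n) 0 = 0 := by
          simp [arithTimes]
        have hb1 := hFk t (by rw [ht]; have := hu.1; simp; positivity)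
          (by rw [ht]; have := hu.2; gcongr)
        have hc : (arithTimes 0 (1 / n) (k + 1) : ℝ) = (k : ℝ) / n + 1 / n := by
          rw [coe_arithTimes]
          · push_cast; ring
          · positivity
          · push_cast
            rw [zero_add, mul_one_div, div_le_one hn']
            exact hk'
        have hb2 := hFk (arithTimes 0 (1 / n) (k + 1)) (by rw [hc]; simp) hc.le
        -- Path minus chord is the increment up to `t` minus `u` times the increment over the whole
        -- cell; each contributes at most `δ / 2`.
        rw [ContinuousMap.sub_apply, hz, sum_pathIncrement, e0, h0, Real.norm_eq_abs]
        simp only [pathIncrement]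
        rw [e1] at hb1 hb2
        rw [abs_le] at hb1 hb2 ⊢
        constructor <;> nlinarith [hu.1, hu.2, hb1.1, hb1.2, hb2.1, hb2.2]
    _ ≤ 0 + ∑ k ∈ Finset.range n, P (F k) :=
        (measure_union_le _ _).trans (add_le_add hnull.le (measure_biUnion_finset_le _ _))
    _ ≤ _ := by
        rw [zero_add]
        refine (Finset.sum_le_sum hF).trans ?_
        simp

end Wiener

/-! ### Gaussian moments -/

section GaussianMoments

variable (v : NNReal)

theorem integrable_pow_gaussianReal (k : ℕ) : Integrable (fun x => x ^ k) (gaussianReal 0 v) := by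
  have := (memLp_id_gaussianReal (μ := 0) (v := v) k).integrable_norm_pow'
  rw [← integrable_norm_iff (by fun_prop)]
  simpa using this

theorem integral_sq_gaussianReal : ∫ x, x ^ 2 ∂(gaussianReal 0 v) = v := by
  have h := variance_fun_id_gaussianReal (μ := 0) (v := v)
  rwa [variance_of_integral_eq_zero (by fun_prop) (by simp)] at h

theorem integral_quadratic_gaussianReal (a b c : ℝ) :
    ∫ x, (a + b * x + c * x ^ 2) ∂(gaussianReal 0 v) = a + c * v := by
  have i1 : Integrable (fun x : ℝ => b * x) (gaussianReal 0 v) := by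
    simpa using (integrable_pow_gaussianReal v 1).const_mul b
  have i2 := (integrable_pow_gaussianReal v 2).const_mul c
  have i0 : Integrable (fun x : ℝ => a + b * x) (gaussianReal 0 v) := (integrable_const a).add i1
  rw [integral_add i0 i2, integral_add (integrable_const a) i1, integral_const_mul,
    integral_const_mul, integral_sq_gaussianReal, integral_id_gaussianReal]
  simp

theorem integral_pow_four_gaussianReal : ∫ x, x ^ 4 ∂(gaussianReal 0 v) = 3 * v ^ 2 := by
  have h := iteratedDeriv_mgf_zero (X := id) (μ := gaussianReal 0 v) (by simp) 4
  have hf : ∀ t : ℝ, HasDerivAt (fun t : ℝ => Real.exp (0 * t + v * t ^ 2 / 2))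
      (v * t * Real.exp (0 * t + v * t ^ 2 / 2)) t := by
    intro t
    have h1 : HasDerivAt (fun t : ℝ => 0 * t + v * t ^ 2 / 2) (v * t) t := by
      have := ((hasDerivAt_id t).const_mul 0).add
        (((hasDerivAt_pow 2 t).const_mul (v : ℝ)).div_const 2)
      refine this.congr_deriv ?_
      simp
      ring
    exact h1.exp.congr_deriv (by ring)
  -- Differentiation of a prefactor times the moment generating function; four derivatives at `0`
  -- give the fourth moment.
  have hstep : ∀ (q q' : ℝ → ℝ), (∀ t, HasDerivAt q (q' t) t) →
      deriv (fun t => q t * Real.exp (0 * t + v * t ^ 2 / 2)) =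
        fun t => (q' t + v * t * q t) * Real.exp (0 * t + v * t ^ 2 / 2) := by
    intro q q' hq
    ext t
    rw [((hq t).fun_mul (hf t)).deriv]
    ring
  have d1 : deriv (fun t : ℝ => Real.exp (0 * t + v * t ^ 2 / 2)) =
      fun t => (v * t) * Real.exp (0 * t + v * t ^ 2 / 2) := funext fun t => (hf t).deriv
  have d2 := hstep (fun t => v * t) (fun _ => v) fun t => by
    simpa using (hasDerivAt_id t).const_mul (v : ℝ)
  have d3 := hstep (fun t => v + v * t * (v * t)) (fun t => 2 * v ^ 2 * t) fun t => by
    have := ((hasDerivAt_id t).const_mul (v : ℝ))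
    exact ((this.mul this).const_add (v : ℝ)).congr_deriv (by simp; ring)
  have d4 := hstep (fun t => 2 * v ^ 2 * t + v * t * (v + v * t * (v * t)))
      (fun t => 3 * v ^ 2 + 3 * v ^ 3 * t ^ 2) fun t => by
    have e : (fun t : ℝ => 2 * v ^ 2 * t + v * t * (v + v * t * (v * t))) =
        fun t => 3 * (v : ℝ) ^ 2 * t + v ^ 3 * t ^ 3 := by ext t; ring
    rw [e]
    exact (((hasDerivAt_id t).const_mul (3 * (v : ℝ) ^ 2)).add
      ((hasDerivAt_pow 3 t).const_mul ((v : ℝ) ^ 3))).congr_deriv (by simp; ring)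
  rw [mgf_id_gaussianReal, iteratedDeriv_succ, iteratedDeriv_succ, iteratedDeriv_succ,
    iteratedDeriv_one, d1, d2, d3, d4] at h
  simpa using h.symm

/-- By the arithmetic-geometric inequality, `|x|³ ≤ x² / (2√n) + √n x⁴ / 2`, which reduces the third
absolute moment to the second and fourth: `1/2 + 3/2 = 2`. -/
theorem integral_abs_pow_three_gaussianReal_le {n : ℕ} (hn : 1 ≤ n)
    (hv : (v : ℝ) = 1 / n) :
    Integrable (fun x => |x| ^ 3) (gaussianReal 0 v) ∧
      ∫ x, |x| ^ 3 ∂(gaussianReal 0 v) ≤ 2 / Real.sqrt n ^ 3 := by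
  have hn' : (0 : ℝ) < n := by exact_mod_cast hn
  have hs : 0 < Real.sqrt n := Real.sqrt_pos.2 hn'
  have hsq : Real.sqrt n ^ 2 = n := Real.sq_sqrt hn'.le
  have hint : Integrable (fun x => |x| ^ 3) (gaussianReal 0 v) := by
    simpa [abs_pow] using (integrable_pow_gaussianReal v 3).abs
  refine ⟨hint, ?_⟩
  have i2 := (integrable_pow_gaussianReal v 2).const_mul (1 / (2 * Real.sqrt n))
  have i4 := (integrable_pow_gaussianReal v 4).const_mul (Real.sqrt n / 2)
  calc ∫ x, |x| ^ 3 ∂(gaussianReal 0 v)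
      ≤ ∫ x, (1 / (2 * Real.sqrt n) * x ^ 2 + Real.sqrt n / 2 * x ^ 4) ∂(gaussianReal 0 v) := by
        refine integral_mono hint (i2.add i4) fun x => ?_
        simp only
        have e2 : x ^ 2 = |x| ^ 2 := (sq_abs x).symm
        have e4 : x ^ 4 = |x| ^ 4 := by rw [← abs_pow, abs_of_nonneg (by positivity)]
        rw [e2, e4]
        have : 1 / (2 * Real.sqrt n) * |x| ^ 2 + Real.sqrt n / 2 * |x| ^ 4 - |x| ^ 3 =
            |x| ^ 2 * (1 - Real.sqrt n * |x|) ^ 2 / (2 * Real.sqrt n) := by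
          field_simp
          ring
        have h0 : 0 ≤ |x| ^ 2 * (1 - Real.sqrt n * |x|) ^ 2 / (2 * Real.sqrt n) := by positivity
        linarith
    _ = 2 / Real.sqrt n ^ 3 := by
        rw [integral_add i2 i4, integral_const_mul, integral_const_mul, integral_sq_gaussianReal,
          integral_pow_four_gaussianReal, hv]
        generalize Real.sqrt n = s at hs hsq
        rw [← hsq]
        field_simp
        norm_num

end GaussianMoments

/-! ### Taylor remainders in terms of truncated moments -/

section TaylorBounds

/-- The Taylor remainder bound in terms of the truncated moment of order `p`. -/
theorem min_taylor_le {h p x s : ℝ} (hh : 0 < h) (hh1 : h ≤ 1) (hp : p ∈ Icc (2 : ℝ) 3)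
    (hs : 0 < s) (hx : 0 ≤ x) :
    min (2 / 3 * (x / s / h) ^ 3) (2 * (x / s / h) ^ 2) ≤
      2 * h ^ (-p) * s ^ (-p) * min (x ^ p) (s ^ (p - 2) * x ^ 2) := by
  have hq0 : 0 ≤ x / s := by positivity
  have e1 : 2 * h ^ (-p) * s ^ (-p) * x ^ p = 2 * (x / s / h) ^ p := by
    rw [Real.div_rpow hq0 hh.le, Real.div_rpow hx hs.le, Real.rpow_neg hh.le, Real.rpow_neg hs.le]
    field_simp
  have e2 : 2 * h ^ (-p) * s ^ (-p) * (s ^ (p - 2) * x ^ 2) = 2 * (h ^ (-p) * (x / s) ^ 2) := by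
    have : s ^ (-p) * s ^ (p - 2) = (s ^ 2)⁻¹ := by
      rw [← Real.rpow_add hs, show -p + (p - 2) = ((-2 : ℤ) : ℝ) by push_cast; ring,
        Real.rpow_intCast, zpow_neg]
      rfl
    calc _ = 2 * h ^ (-p) * x ^ 2 * (s ^ (-p) * s ^ (p - 2)) := by ring
      _ = _ := by rw [this]; field_simp
  rw [mul_min_of_nonneg _ _ (by positivity), e1, e2]
  set u := x / s / h with hu
  have hu0 : 0 ≤ u := by positivity
  refine le_min ?_ ((min_le_right _ _).trans ?_)
  -- Since `2 ≤ p ≤ 3`, the power `u ^ p` dominates the cube for `u ≤ 1` and the square for `u ≥ 1`.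
  · rcases le_total u 1 with h1 | h1
    · refine (min_le_left _ _).trans ?_
      have : u ^ 3 ≤ u ^ p := by
        rcases hu0.eq_or_lt with h0 | h0
        · rw [← h0]
          simpa using Real.rpow_nonneg le_rfl p
        · have := Real.rpow_le_rpow_of_exponent_ge h0 h1 hp.2
          simpa using this
      have h3 : 0 ≤ u ^ 3 := by positivity
      linarith
    · refine (min_le_right _ _).trans ?_
      have := Real.rpow_le_rpow_of_exponent_le h1 hp.1
      simp only [Real.rpow_ofNat] at this
      linarith
  · have h1 : (h ^ 2)⁻¹ ≤ h ^ (-p) := by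
      have := Real.rpow_le_rpow_of_exponent_ge hh hh1 (neg_le_neg hp.1)
      rwa [Real.rpow_neg hh.le, Real.rpow_ofNat] at this
    rw [hu, div_pow, div_eq_inv_mul]
    gcongr

theorem taylor_bound_mono {x y : ℝ} (hxy : |x| ≤ |y|) :
    min (2 / 3 * |x| ^ 3) (2 * x ^ 2) ≤ min (2 / 3 * |y| ^ 3) (2 * y ^ 2) := by
  rw [← sq_abs x, ← sq_abs y]
  gcongr

/-- The Gaussian average of `smoothMean h T` against its Taylor polynomial of order two. -/
theorem taylor_le_integral_smoothMean {h : ℝ} (hh : 0 < h) {T : ℝ → ℝ} (hT : Continuous T)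
    (h01 : ∀ t, T t ∈ Icc (0 : ℝ) 1) {n : ℕ} (hn : 1 ≤ n) (v : NNReal) (hv : (v : ℝ) = 1 / n) :
    smoothMean h T 0 + smoothMeanDeriv₂ h T 0 / (2 * n) ≤
      ∫ g, smoothMean h T g ∂(gaussianReal 0 v) + 4 / 3 / (h * Real.sqrt n) ^ 3 := by
  obtain ⟨i3, b3⟩ := integral_abs_pow_three_gaussianReal_le v hn hv
  have i1 : Integrable (fun x : ℝ => x) (gaussianReal 0 v) := by
    simpa using integrable_pow_gaussianReal v 1
  have i2 := integrable_pow_gaussianReal v 2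
  have hw : Integrable (smoothMean h T) (gaussianReal 0 v) := by
    refine Integrable.of_bound (C := 1) ?_ (.of_forall fun g => ?_)
    · exact (continuous_windowMean h (continuous_windowMean h
        (continuous_windowMean h hT))).aestronglyMeasurable
    · have := smoothMean_mem_Icc hh.le hT h01 g
      rw [Real.norm_eq_abs, abs_of_nonneg this.1]
      exact this.2
  have hle : ∫ g, (smoothMean h T 0 + smoothMeanDeriv h T 0 * g
      + smoothMeanDeriv₂ h T 0 / 2 * g ^ 2) ∂(gaussianReal 0 v) ≤
      ∫ g, (smoothMean h T g + 2 / 3 / h ^ 3 * |g| ^ 3) ∂(gaussianReal 0 v) := by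
    refine integral_mono (((integrable_const _).add (i1.const_mul _)).add (i2.const_mul _))
      (hw.add (i3.const_mul _)) fun g => ?_
    have := (abs_le.1 ((abs_smoothMean_taylor_le hh hT h01 0 g).trans (min_le_left _ _))).1
    rw [abs_div, abs_of_pos hh, div_pow, zero_add] at this
    have e : 2 / 3 / h ^ 3 * |g| ^ 3 = 2 / 3 * (|g| ^ 3 / h ^ 3) := by ring
    simp only [e]
    linarith
  rw [integral_quadratic_gaussianReal, integral_add hw (i3.const_mul _), integral_const_mul,
    hv] at hle
  have hb : 2 / 3 / h ^ 3 * ∫ x, |x| ^ 3 ∂(gaussianReal 0 v) ≤ 4 / 3 / (h * Real.sqrt n) ^ 3 := by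
    refine (mul_le_mul_of_nonneg_left b3 (by positivity)).trans (le_of_eq ?_)
    have hs : 0 < Real.sqrt n := Real.sqrt_pos.2 (by exact_mod_cast hn)
    field_simp
    norm_num
  have e : smoothMeanDeriv₂ h T 0 / 2 * (1 / n) = smoothMeanDeriv₂ h T 0 / (2 * n) := by
    field_simp
  rw [e] at hle
  linarith

end TaylorBounds

/-! ### Sublinear expectations and the near-optimal mean and deviation -/

namespace SublinearExpectation

variable {Ω : Type*} (S : SublinearExpectation Ω)

theorem E_add_const {Y : Ω → ℝ} (hY : Y ∈ S.H) (c : ℝ) : S.E (fun ω => Y ω + c) = S.E Y + c := by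
  have hmem : (fun ω => Y ω + c) ∈ S.H := S.H.add_mem hY (S.const_mem c)
  apply le_antisymm
  · have := S.subadd Y hY _ (S.const_mem c)
    rwa [S.const] at this
  · have := S.subadd _ hmem _ (S.const_mem (-c))
    rw [S.const] at this
    have e : ((fun ω => Y ω + c) + fun _ => -c) = Y := by
      ext ω
      simp
    rw [e] at this
    linarith

theorem E_const_mul {Y : Ω → ℝ} (hY : Y ∈ S.H) {t : ℝ} (ht : 0 ≤ t) :
    S.E (fun ω => t * Y ω) = t * S.E Y :=
  S.pos_homog t ht Y hY

theorem E_neg_const_mul {Y : Ω → ℝ} (hY : Y ∈ S.H) {t : ℝ} (ht : t ≤ 0) :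
    S.E (fun ω => t * Y ω) = t * S.lowerE Y := by
  have := S.pos_homog (-t) (by linarith) (-Y) (S.H.neg_mem hY)
  rw [lowerE, mul_neg, ← neg_mul, ← this]
  congr 1
  ext ω
  simp

theorem lowerE_le_E {Y : Ω → ℝ} (hY : Y ∈ S.H) : S.lowerE Y ≤ S.E Y := by
  have h := S.subadd Y hY (-Y) (S.H.neg_mem hY)
  have h0 : S.E (Y + -Y) = 0 := by
    rw [add_neg_cancel]
    exact S.const 0
  rw [lowerE]
  linarith

theorem lowerE_add_const {Y : Ω → ℝ} (hY : Y ∈ S.H) (c : ℝ) :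
    S.lowerE (fun ω => Y ω + c) = S.lowerE Y + c := by
  have e : -(fun ω => Y ω + c) = fun ω => (-Y) ω + -c := by
    ext ω
    simp [add_comm]
  rw [lowerE, e, S.E_add_const (S.H.neg_mem hY), lowerE]
  ring

theorem E_nonneg {Y : Ω → ℝ} (hY : Y ∈ S.H) (h : ∀ ω, 0 ≤ Y ω) : 0 ≤ S.E Y := by
  have := S.mono _ (S.const_mem 0) _ hY h
  rwa [S.const] at this

theorem lowerE_nonneg {Y : Ω → ℝ} (hY : Y ∈ S.H) (h : ∀ ω, 0 ≤ Y ω) : 0 ≤ S.lowerE Y := by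
  have := S.mono _ (S.H.neg_mem hY) _ (S.const_mem 0) (fun ω => by simpa using h ω)
  rw [S.const] at this
  rw [lowerE]
  linarith

/-- A sublinear expectation is convex, hence continuous, along lines. -/
theorem continuous_E_add_smul {Y Z : Ω → ℝ} (hY : Y ∈ S.H) (hZ : Z ∈ S.H) :
    Continuous fun t : ℝ => S.E (Y + t • Z) := by
  have hm : ∀ t : ℝ, Y + t • Z ∈ S.H := fun t => S.H.add_mem hY (S.H.smul_mem t hZ)
  have hconv : ConvexOn ℝ univ fun t : ℝ => S.E (Y + t • Z) := by
    refine ⟨convex_univ, fun x _ y _ a b ha hb hab => ?_⟩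
    have e : Y + (a • x + b • y) • Z = a • (Y + x • Z) + b • (Y + y • Z) := by
      ext ω
      simp only [Pi.add_apply, Pi.smul_apply, smul_eq_mul]
      linear_combination (-(Y ω)) * hab
    simp only
    rw [e]
    refine (S.subadd _ (S.H.smul_mem _ (hm x)) _ (S.H.smul_mem _ (hm y))).trans (le_of_eq ?_)
    rw [S.pos_homog a ha _ (hm x), S.pos_homog b hb _ (hm y)]
    rfl
  rw [← continuousOn_univ]
  exact hconv.continuousOn isOpen_univ

variable {S} {X₀ : Ω → ℝ}

theorem sub_mem (hX : X₀ ∈ S.H) (μ : ℝ) : (fun ω => X₀ ω - μ) ∈ S.H :=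
  S.H.sub_mem hX (S.const_mem μ)

theorem sdInf_le_sdLower {μ : ℝ} (hμ : μ ∈ S.meanInterval X₀) : S.sdInf X₀ ≤ S.sdLower X₀ μ :=
  csInf_le ⟨0, by rintro _ ⟨μ, -, rfl⟩; exact Real.sqrt_nonneg _⟩ (mem_image_of_mem _ hμ)

namespace MomentCondition

variable (h : S.MomentCondition X₀)
include h

theorem sq_sub_mem (μ : ℝ) : (fun ω => (X₀ ω - μ) ^ 2) ∈ S.H := by
  have e : (fun ω => (X₀ ω - μ) ^ 2) =
      (fun ω => X₀ ω ^ 2) + (-2 * μ) • X₀ + fun _ => μ ^ 2 := by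
    ext ω
    simp only [Pi.add_apply, Pi.smul_apply, smul_eq_mul]
    ring
  rw [e]
  exact S.H.add_mem (S.H.add_mem h.sq_mem (S.H.smul_mem _ h.mem)) (S.const_mem _)

theorem sdLower_sq (μ : ℝ) : S.sdLower X₀ μ ^ 2 = S.lowerE (fun ω => (X₀ ω - μ) ^ 2) :=
  Real.sq_sqrt (S.lowerE_nonneg (h.sq_sub_mem μ) fun _ => sq_nonneg _)

theorem sdUpper_sq (μ : ℝ) : S.sdUpper X₀ μ ^ 2 = S.E (fun ω => (X₀ ω - μ) ^ 2) :=
  Real.sq_sqrt (S.E_nonneg (h.sq_sub_mem μ) fun _ => sq_nonneg _)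

theorem sdLower_le_sdUpper (μ : ℝ) : S.sdLower X₀ μ ≤ S.sdUpper X₀ μ :=
  Real.sqrt_le_sqrt (S.lowerE_le_E (h.sq_sub_mem μ))

/-- The square is `E[X₀² - 2μX₀] + μ²`, whose first term is convex in `μ`. Continuity in `μ` is
needed because the mean will itself depend on the history. -/
theorem continuous_sdUpper : Continuous (S.sdUpper X₀) := by
  refine Real.continuous_sqrt.comp ?_
  have hc := ((S.continuous_E_add_smul h.sq_mem h.mem).comp
    (by fun_prop : Continuous fun μ : ℝ => -2 * μ)).add (by fun_prop : Continuous fun μ : ℝ => μ ^ 2)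
  convert hc using 2 with μ
  change _ = S.E ((fun ω => X₀ ω ^ 2) + (-2 * μ) • X₀) + μ ^ 2
  rw [← S.E_add_const (S.H.add_mem h.sq_mem (S.H.smul_mem _ h.mem))]
  congr 1
  ext ω
  simp only [Pi.add_apply, Pi.smul_apply, smul_eq_mul]
  ring

theorem continuous_sdLower : Continuous (S.sdLower X₀) := by
  refine Real.continuous_sqrt.comp ?_
  have hc := ((S.continuous_E_add_smul (S.H.neg_mem h.sq_mem) h.mem).comp
    (by fun_prop : Continuous fun μ : ℝ => 2 * μ)).neg.add
      (by fun_prop : Continuous fun μ : ℝ => μ ^ 2)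
  convert hc using 2 with μ
  have hm : (fun ω => X₀ ω ^ 2 + (-2 * μ) * X₀ ω) ∈ S.H :=
    S.H.add_mem h.sq_mem (S.H.smul_mem (-2 * μ) h.mem)
  have e : (fun ω => (X₀ ω - μ) ^ 2) = fun ω => (X₀ ω ^ 2 + (-2 * μ) * X₀ ω) + μ ^ 2 := by
    ext ω
    ring
  rw [e, S.lowerE_add_const hm, lowerE]
  congr 3
  ext ω
  simp only [Pi.neg_apply, Pi.add_apply, Pi.smul_apply, smul_eq_mul]
  ring

theorem le_sdSup {μ : ℝ} (hμ : μ ∈ S.meanInterval X₀) : S.sdUpper X₀ μ ≤ S.sdSup X₀ :=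
  le_csSup h.sdSup_finite (mem_image_of_mem _ hμ)

theorem sdLower_pos {μ : ℝ} (hμ : μ ∈ S.meanInterval X₀) : 0 < S.sdLower X₀ μ :=
  h.sdInf_pos.trans_le (sdInf_le_sdLower hμ)

theorem lowerE_mem_meanInterval : S.lowerE X₀ ∈ S.meanInterval X₀ :=
  ⟨le_rfl, S.lowerE_le_E h.mem⟩

end MomentCondition

/-- The weight that moves linearly from `0` to `1` as `b` runs through `[-τ, τ]`. -/
noncomputable def rampWeight (τ b : ℝ) : ℝ := max 0 (min 1 ((b + τ) / (2 * τ)))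

theorem rampWeight_mem_Icc (τ b : ℝ) : rampWeight τ b ∈ Icc (0 : ℝ) 1 :=
  ⟨le_max_left _ _, max_le zero_le_one (min_le_left _ _)⟩

theorem continuous_rampWeight (τ : ℝ) : Continuous (rampWeight τ) := by
  unfold rampWeight
  fun_prop

theorem mul_one_sub_rampWeight_le {τ b : ℝ} (hτ : 0 < τ) (hb : 0 ≤ b) :
    b * (1 - rampWeight τ b) ≤ τ := by
  obtain ⟨h0, h1⟩ := rampWeight_mem_Icc τ b
  rcases le_total b τ with h | h
  · nlinarith
  · have : rampWeight τ b = 1 := by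
      rw [rampWeight, min_eq_left ((one_le_div (by positivity)).2 (by linarith)),
        max_eq_right zero_le_one]
    rw [this]
    linarith

theorem neg_mul_rampWeight_le {τ b : ℝ} (hτ : 0 < τ) (hb : b ≤ 0) :
    -b * rampWeight τ b ≤ τ := by
  obtain ⟨h0, h1⟩ := rampWeight_mem_Icc τ b
  rcases le_total (-τ) b with h | h
  · nlinarith
  · have : rampWeight τ b = 0 := by
      rw [rampWeight, max_eq_left]
      exact (min_le_right _ _).trans (div_nonpos_of_nonpos_of_nonneg (by linarith) (by linarith))
    rw [this]
    linarith

variable (S X₀) in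
/-- The mean chosen when `b` is the slope of the value function. -/
noncomputable def chosenMean (τ b : ℝ) : ℝ :=
  S.lowerE X₀ + (S.E X₀ - S.lowerE X₀) * rampWeight τ b

variable (S X₀) in
/-- The standard deviation chosen when `c` is the curvature of the value function. -/
noncomputable def chosenSd (τ μ c : ℝ) : ℝ :=
  S.sdLower X₀ μ + (S.sdUpper X₀ μ - S.sdLower X₀ μ) * rampWeight τ c

namespace MomentCondition

variable (h : S.MomentCondition X₀)
include h

theorem chosenMean_mem (τ b : ℝ) : S.chosenMean X₀ τ b ∈ S.meanInterval X₀ := by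
  obtain ⟨h0, h1⟩ := rampWeight_mem_Icc τ b
  have := S.lowerE_le_E h.mem
  constructor <;> rw [chosenMean] <;> nlinarith

theorem chosenSd_mem (τ μ c : ℝ) :
    S.chosenSd X₀ τ μ c ∈ Icc (S.sdLower X₀ μ) (S.sdUpper X₀ μ) := by
  obtain ⟨h0, h1⟩ := rampWeight_mem_Icc τ c
  have := h.sdLower_le_sdUpper μ
  constructor <;> rw [chosenSd] <;> nlinarith

theorem continuous_chosenSd (τ : ℝ) :
    Continuous fun q : ℝ × ℝ => S.chosenSd X₀ τ q.1 q.2 := by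
  have h1 := h.continuous_sdLower
  have h2 := h.continuous_sdUpper
  have h3 := continuous_rampWeight τ
  unfold chosenSd
  fun_prop

/-- With `μ` at the end of the interval selected by the sign of `b` the left side would vanish. The
ramp misses that end only for `|b| < τ`, where the slope itself is small. -/
theorem E_linear_chosenMean_le {τ b : ℝ} (hτ : 0 < τ) {t : ℝ} (ht : 0 ≤ t) :
    S.E (fun ω => b * t * (X₀ ω - S.chosenMean X₀ τ b)) ≤ t * τ * (S.E X₀ - S.lowerE X₀) := by
  have hle := S.lowerE_le_E h.mem
  have hw : 0 ≤ t * (S.E X₀ - S.lowerE X₀) := mul_nonneg ht (by linarith)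
  rcases le_total 0 b with hb | hb
  · rw [S.E_const_mul (sub_mem h.mem _) (mul_nonneg hb ht)]
    simp only [sub_eq_add_neg (X₀ _)]
    rw [S.E_add_const h.mem]
    have := mul_le_mul_of_nonneg_left (mul_one_sub_rampWeight_le hτ hb) hw
    rw [chosenMean]
    linarith
  · rw [S.E_neg_const_mul (sub_mem h.mem _) (mul_nonpos_of_nonpos_of_nonneg hb ht)]
    simp only [sub_eq_add_neg (X₀ _)]
    rw [S.lowerE_add_const h.mem]
    have := mul_le_mul_of_nonneg_left (neg_mul_rampWeight_le hτ hb) hw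
    rw [chosenMean]
    linarith

/-- The same device for the curvature: the sign of `c` decides whether the upper or the lower
variance is the one that `E` sees. -/
theorem E_sq_chosenSd_le {τ c : ℝ} (hτ : 0 < τ) {t : ℝ} (ht : 0 ≤ t) (μ : ℝ) :
    S.E (fun ω => c * t * (X₀ ω - μ) ^ 2) ≤
      c * t * S.chosenSd X₀ τ μ c ^ 2 + 2 * t * τ * S.sdUpper X₀ μ ^ 2 := by
  obtain ⟨h0, h1⟩ := rampWeight_mem_Icc τ c
  have hl : 0 ≤ S.sdLower X₀ μ := Real.sqrt_nonneg _
  have hlu := h.sdLower_le_sdUpper μ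
  obtain ⟨hm1, hm2⟩ := h.chosenSd_mem τ μ c
  rcases le_total 0 c with hc | hc
  · rw [S.E_const_mul (h.sq_sub_mem _) (mul_nonneg hc ht), ← h.sdUpper_sq]
    have hr := mul_one_sub_rampWeight_le hτ hc
    have e : S.sdUpper X₀ μ - S.chosenSd X₀ τ μ c =
        (S.sdUpper X₀ μ - S.sdLower X₀ μ) * (1 - rampWeight τ c) := by rw [chosenSd]; ring
    have k1 : c * (S.sdUpper X₀ μ ^ 2 - S.chosenSd X₀ τ μ c ^ 2) ≤
        2 * τ * S.sdUpper X₀ μ ^ 2 := by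
      calc c * (S.sdUpper X₀ μ ^ 2 - S.chosenSd X₀ τ μ c ^ 2)
          = (c * (1 - rampWeight τ c)) * ((S.sdUpper X₀ μ - S.sdLower X₀ μ) *
            (S.sdUpper X₀ μ + S.chosenSd X₀ τ μ c)) := by
            rw [sq_sub_sq, e]; ring
        _ ≤ τ * ((S.sdUpper X₀ μ - S.sdLower X₀ μ) *
            (S.sdUpper X₀ μ + S.chosenSd X₀ τ μ c)) := by
            apply mul_le_mul_of_nonneg_right hr
            apply mul_nonneg <;> linarith
        _ ≤ τ * (S.sdUpper X₀ μ * (S.sdUpper X₀ μ + S.sdUpper X₀ μ)) := by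
            gcongr <;> linarith
        _ = _ := by ring
    have := mul_le_mul_of_nonneg_left k1 ht
    linarith
  · rw [S.E_neg_const_mul (h.sq_sub_mem _) (mul_nonpos_of_nonpos_of_nonneg hc ht),
      ← h.sdLower_sq]
    have hr := neg_mul_rampWeight_le hτ hc
    have e : S.chosenSd X₀ τ μ c - S.sdLower X₀ μ =
        (S.sdUpper X₀ μ - S.sdLower X₀ μ) * rampWeight τ c := by rw [chosenSd]; ring
    have k1 : -c * (S.chosenSd X₀ τ μ c ^ 2 - S.sdLower X₀ μ ^ 2) ≤
        2 * τ * S.sdUpper X₀ μ ^ 2 := by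
      calc -c * (S.chosenSd X₀ τ μ c ^ 2 - S.sdLower X₀ μ ^ 2)
          = (-c * rampWeight τ c) * ((S.sdUpper X₀ μ - S.sdLower X₀ μ) *
            (S.chosenSd X₀ τ μ c + S.sdLower X₀ μ)) := by
            rw [sq_sub_sq, e]; ring
        _ ≤ τ * ((S.sdUpper X₀ μ - S.sdLower X₀ μ) *
            (S.chosenSd X₀ τ μ c + S.sdLower X₀ μ)) := by
            apply mul_le_mul_of_nonneg_right hr
            apply mul_nonneg <;> linarith
        _ ≤ τ * (S.sdUpper X₀ μ * (S.sdUpper X₀ μ + S.sdUpper X₀ μ)) := by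
            gcongr <;> linarith
        _ = _ := by ring
    have := mul_le_mul_of_nonneg_left k1 ht
    linarith

/-- For the chosen mean and standard deviation, a quadratic polynomial of the normalized variable
has nearly the upper expectation that it would have under mean zero and variance one. -/
theorem E_quadratic_le {τ : ℝ} (hτ : 0 < τ) (b c : ℝ) {s : ℝ} (hs : 1 ≤ s) :
    S.E (fun ω => b * ((X₀ ω - S.chosenMean X₀ τ b) /
        (S.chosenSd X₀ τ (S.chosenMean X₀ τ b) c * s)) + c / 2 * ((X₀ ω - S.chosenMean X₀ τ b) /
        (S.chosenSd X₀ τ (S.chosenMean X₀ τ b) c * s)) ^ 2) ≤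
      c / (2 * s ^ 2) + τ * ((S.E X₀ - S.lowerE X₀) / S.sdInf X₀ +
        S.sdSup X₀ ^ 2 / S.sdInf X₀ ^ 2) := by
  set μ := S.chosenMean X₀ τ b with hμ
  set sd := S.chosenSd X₀ τ μ c with hsd
  have hμm : μ ∈ S.meanInterval X₀ := h.chosenMean_mem τ b
  have hsdm := h.chosenSd_mem τ μ c
  have hinf := h.sdInf_pos
  have hsdi : S.sdInf X₀ ≤ sd := (sdInf_le_sdLower hμm).trans hsdm.1
  have hsd0 : 0 < sd := hinf.trans_le hsdi
  have hs0 : 0 < s := by linarith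
  have hm1 : (fun ω => b * (1 / (sd * s)) * (X₀ ω - μ)) ∈ S.H :=
    S.H.smul_mem (b * (1 / (sd * s))) (sub_mem h.mem μ)
  have hm2 : (fun ω => c * (1 / (2 * (sd * s) ^ 2)) * (X₀ ω - μ) ^ 2) ∈ S.H :=
    S.H.smul_mem (c * (1 / (2 * (sd * s) ^ 2))) (h.sq_sub_mem μ)
  have e : (fun ω => b * ((X₀ ω - μ) / (sd * s)) + c / 2 * ((X₀ ω - μ) / (sd * s)) ^ 2) =
      (fun ω => b * (1 / (sd * s)) * (X₀ ω - μ)) +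
        fun ω => c * (1 / (2 * (sd * s) ^ 2)) * (X₀ ω - μ) ^ 2 := by
    ext ω
    simp only [Pi.add_apply]
    field_simp
  rw [e]
  refine (S.subadd _ hm1 _ hm2).trans ?_
  have h1 := h.E_linear_chosenMean_le (b := b) hτ (t := 1 / (sd * s)) (by positivity)
  have h2 := h.E_sq_chosenSd_le (c := c) hτ (t := 1 / (2 * (sd * s) ^ 2)) (by positivity) μ
  rw [← hμ] at h1
  rw [← hsd] at h2
  have hle := S.lowerE_le_E h.mem
  have hup := h.le_sdSup hμm
  have hup0 : 0 ≤ S.sdUpper X₀ μ := Real.sqrt_nonneg _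
  have k1 : 1 / (sd * s) * τ * (S.E X₀ - S.lowerE X₀) ≤
      τ * ((S.E X₀ - S.lowerE X₀) / S.sdInf X₀) := by
    have : 1 / (sd * s) ≤ 1 / S.sdInf X₀ := by
      apply one_div_le_one_div_of_le hinf
      nlinarith
    calc _ = 1 / (sd * s) * (τ * (S.E X₀ - S.lowerE X₀)) := by ring
      _ ≤ 1 / S.sdInf X₀ * (τ * (S.E X₀ - S.lowerE X₀)) := by
        apply mul_le_mul_of_nonneg_right this
        apply mul_nonneg hτ.le
        linarith
      _ = _ := by ring
  have k2 : 2 * (1 / (2 * (sd * s) ^ 2)) * τ * S.sdUpper X₀ μ ^ 2 ≤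
      τ * (S.sdSup X₀ ^ 2 / S.sdInf X₀ ^ 2) := by
    have : 1 / (sd * s) ^ 2 ≤ 1 / S.sdInf X₀ ^ 2 := by
      apply one_div_le_one_div_of_le (by positivity)
      have : S.sdInf X₀ ≤ sd * s := by nlinarith
      gcongr
    calc _ = 1 / (sd * s) ^ 2 * (τ * S.sdUpper X₀ μ ^ 2) := by field_simp
      _ ≤ 1 / S.sdInf X₀ ^ 2 * (τ * S.sdSup X₀ ^ 2) := by gcongr
      _ = _ := by ring
  have k3 : c * (1 / (2 * (sd * s) ^ 2)) * sd ^ 2 = c / (2 * s ^ 2) := by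
    field_simp
  rw [k3] at h2
  linarith

end MomentCondition

end SublinearExpectation

/-! ### The truncated moment and the Lindeberg step -/

namespace SublinearExpectation

section Gamma

variable {Ω : Type*} {S : SublinearExpectation Ω} {X₀ : Ω → ℝ}

/-- The constant is the maximum of `x² - x³` on `[0, 1]`, attained at `2/3`. -/
theorem sq_sub_le_truncated {x p C : ℝ} (hx : 0 ≤ x) (hp : p ∈ Icc (2 : ℝ) 3) (hC : 1 ≤ C) :
    x ^ 2 - 4 / 27 ≤ min (x ^ p) (C ^ (p - 2) * x ^ 2) := by
  refine le_min ?_ ?_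
  · rcases le_total x 1 with h1 | h1
    · have h3 : x ^ 3 ≤ x ^ p := by
        rcases hx.eq_or_lt with h0 | h0
        · rw [← h0]
          simpa using Real.rpow_nonneg le_rfl p
        · simpa using Real.rpow_le_rpow_of_exponent_ge h0 h1 hp.2
      nlinarith [mul_nonneg (sq_nonneg (x - 2 / 3)) (by linarith : 0 ≤ x + 1 / 3)]
    · have := Real.rpow_le_rpow_of_exponent_le h1 hp.1
      simp only [Real.rpow_ofNat] at this
      linarith
  · have : 1 ≤ C ^ (p - 2) := Real.one_le_rpow hC (by linarith [hp.1])
    nlinarith [sq_nonneg x]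

theorem extE_le {g Y : Ω → ℝ} (hY : Y ∈ S.H) (hg : ∀ ω, g ω ≤ Y ω) :
    S.extE g ≤ (S.E Y : EReal) := by
  unfold extE
  exact sInf_le ⟨Y, hY, hg, rfl⟩

namespace MomentCondition

variable (h : S.MomentCondition X₀)
include h

theorem const_mul_sq_normalized_mem (μ C : ℝ) :
    (fun ω => C * ((X₀ ω - μ) / S.sdLower X₀ μ) ^ 2) ∈ S.H ∧
      (0 ≤ C → S.E (fun ω => C * ((X₀ ω - μ) / S.sdLower X₀ μ) ^ 2) =
        C * (S.sdUpper X₀ μ / S.sdLower X₀ μ) ^ 2) := by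
  have e : (fun ω => C * ((X₀ ω - μ) / S.sdLower X₀ μ) ^ 2) =
      fun ω => (C / S.sdLower X₀ μ ^ 2) * (X₀ ω - μ) ^ 2 := by
    ext ω
    rw [div_pow]
    ring
  rw [e]
  refine ⟨S.H.smul_mem (C / S.sdLower X₀ μ ^ 2) (h.sq_sub_mem μ), fun hC => ?_⟩
  rw [S.E_const_mul (h.sq_sub_mem μ) (by positivity), ← h.sdUpper_sq, div_pow]
  ring

theorem gammaSup_le {p C : ℝ} (hC : 0 ≤ C) :
    S.gammaSup X₀ p C ≤ ((C ^ (p - 2) * (S.sdSup X₀ / S.sdInf X₀) ^ 2 : ℝ) : EReal) := by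
  refine iSup₂_le fun μ hμ => ?_
  have hC' : 0 ≤ C ^ (p - 2) := Real.rpow_nonneg hC _
  obtain ⟨hm, hE⟩ := h.const_mul_sq_normalized_mem μ (C ^ (p - 2))
  refine (extE_le hm fun ω => min_le_right _ _).trans ?_
  rw [EReal.coe_le_coe_iff, hE hC']
  have hi := h.sdInf_pos
  have h1 := sdInf_le_sdLower hμ
  have h2 := h.le_sdSup hμ
  have h3 : 0 ≤ S.sdUpper X₀ μ := Real.sqrt_nonneg _
  have h4 : 0 ≤ S.sdSup X₀ := h3.trans h2
  have h5 := h.sdLower_pos hμ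
  gcongr

/-- Normalizing by the lower deviation makes `E[ξ²] ≥ 1`, and truncation removes at most `4/27`. The
bound lets Gaussian errors be absorbed into those involving `γ`. -/
theorem le_gammaSup {p C : ℝ} (hp : p ∈ Icc (2 : ℝ) 3) (hC : 1 ≤ C) :
    ((23 / 27 : ℝ) : EReal) ≤ S.gammaSup X₀ p C := by
  have hμ := h.lowerE_mem_meanInterval
  set μ := S.lowerE X₀
  refine le_trans ?_ (le_iSup₂ (f := fun μ _ => S.gammaAt X₀ p μ C) μ hμ)
  refine le_sInf ?_
  rintro _ ⟨Y, hY, hYg, rfl⟩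
  rw [EReal.coe_le_coe_iff]
  obtain ⟨hm, hE⟩ := h.const_mul_sq_normalized_mem μ 1
  have hl := h.sdLower_pos hμ
  have hlu := h.sdLower_le_sdUpper μ
  have h1 : 1 ≤ (S.sdUpper X₀ μ / S.sdLower X₀ μ) ^ 2 :=
    one_le_pow₀ ((one_le_div hl).2 hlu)
  have h2 := S.mono _ (S.H.add_mem hm (S.const_mem (-(4 / 27)))) Y hY fun ω => by
    refine le_trans ?_ (hYg ω)
    have := sq_sub_le_truncated (abs_nonneg ((X₀ ω - μ) / S.sdLower X₀ μ)) hp hC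
    rw [sq_abs] at this
    simp only [Pi.add_apply]
    linarith
  have h3 := S.E_add_const hm (-(4 / 27))
  have h4 := hE zero_le_one
  change S.E (fun ω => 1 * ((X₀ ω - μ) / S.sdLower X₀ μ) ^ 2 + -(4 / 27)) ≤ _ at h2
  linarith

theorem coe_toReal_gammaSup {p C : ℝ} (hp : p ∈ Icc (2 : ℝ) 3) (hC : 1 ≤ C) :
    ((S.gammaSup X₀ p C).toReal : EReal) = S.gammaSup X₀ p C := by
  refine EReal.coe_toReal (ne_top_of_le_ne_top (EReal.coe_ne_top _) (h.gammaSup_le (by linarith)))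
    ?_
  exact ne_bot_of_le_ne_bot (EReal.coe_ne_bot _) (h.le_gammaSup hp hC)

theorem le_toReal_gammaSup {p C : ℝ} (hp : p ∈ Icc (2 : ℝ) 3) (hC : 1 ≤ C) :
    23 / 27 ≤ (S.gammaSup X₀ p C).toReal := by
  rw [← EReal.coe_le_coe_iff, h.coe_toReal_gammaSup hp hC]
  exact h.le_gammaSup hp hC

/-- The truncated power is not assumed to lie in `H`, so a nearly optimal majorant in `H` stands in
for it. -/
theorem exists_dominating {p C : ℝ} (hp : p ∈ Icc (2 : ℝ) 3) (hC : 1 ≤ C) {μ : ℝ}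
    (hμ : μ ∈ S.meanInterval X₀) {η : ℝ} (hη : 0 < η) :
    ∃ Y ∈ S.H, (∀ ω, min (|(X₀ ω - μ) / S.sdLower X₀ μ| ^ p)
      (C ^ (p - 2) * ((X₀ ω - μ) / S.sdLower X₀ μ) ^ 2) ≤ Y ω) ∧
      S.E Y ≤ (S.gammaSup X₀ p C).toReal + η := by
  have h1 : S.gammaAt X₀ p μ C < (((S.gammaSup X₀ p C).toReal + η : ℝ) : EReal) := by
    refine lt_of_le_of_lt (le_iSup₂ (f := fun μ _ => S.gammaAt X₀ p μ C) μ hμ) ?_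
    change S.gammaSup X₀ p C < _
    rw [← h.coe_toReal_gammaSup hp hC, EReal.coe_lt_coe_iff, EReal.toReal_coe]
    linarith
  obtain ⟨_, ⟨Y, hY, hYg, rfl⟩, hlt⟩ := sInf_lt_iff.1 h1
  exact ⟨Y, hY, hYg, (EReal.coe_lt_coe_iff.1 hlt).le⟩

theorem quadratic_mem (b c μ d : ℝ) :
    (fun ω => b * ((X₀ ω - μ) / d) + c / 2 * ((X₀ ω - μ) / d) ^ 2) ∈ S.H := by
  have e : (fun ω => b * ((X₀ ω - μ) / d) + c / 2 * ((X₀ ω - μ) / d) ^ 2) =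
      (b / d) • (fun ω => X₀ ω - μ) + (c / 2 / d ^ 2) • fun ω => (X₀ ω - μ) ^ 2 := by
    ext ω
    simp only [Pi.add_apply, Pi.smul_apply, smul_eq_mul, div_pow]
    ring
  rw [e]
  exact S.H.add_mem (S.H.smul_mem _ (sub_mem h.mem μ)) (S.H.smul_mem _ (h.sq_sub_mem μ))

/-- One Lindeberg step: for a suitable choice of mean and standard deviation, the normalized
variable may be replaced by a Gaussian variable under `smoothMean ℓ T`. -/
theorem exists_smoothMean_step_le {n : ℕ} (hn : 1 ≤ n) {p : ℝ} (hp : p ∈ Icc (2 : ℝ) 3) {ℓ : ℝ}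
    (hℓ : 0 < ℓ) (hℓ1 : ℓ ≤ 1) {v : NNReal} (hv : (v : ℝ) = 1 / n) {ρ : ℝ} (hρ : 0 < ρ) :
    ∃ τ > 0, ∀ T : ℝ → ℝ, Continuous T → (∀ t, T t ∈ Icc (0 : ℝ) 1) → ∀ μ sd : ℝ,
      μ = S.chosenMean X₀ τ (smoothMeanDeriv ℓ T 0) →
      sd = S.chosenSd X₀ τ μ (smoothMeanDeriv₂ ℓ T 0) →
      (fun ω => smoothMean ℓ T ((X₀ ω - μ) / (sd * Real.sqrt n))) ∈ S.H →
      S.E (fun ω => smoothMean ℓ T ((X₀ ω - μ) / (sd * Real.sqrt n))) ≤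
        ∫ g, smoothMean ℓ T g ∂(gaussianReal 0 v) +
        (2 * ℓ ^ (-p) * Real.sqrt n ^ (-p) * (S.gammaSup X₀ p (Real.sqrt n)).toReal +
          4 / 3 / (ℓ * Real.sqrt n) ^ 3 + ρ) := by
  have hn' : (1 : ℝ) ≤ n := by exact_mod_cast hn
  have hs1 : 1 ≤ Real.sqrt n := Real.one_le_sqrt.2 hn'
  have hs0 : 0 < Real.sqrt n := by linarith
  have hsq : Real.sqrt n ^ 2 = n := Real.sq_sqrt (by linarith)
  set M := (S.E X₀ - S.lowerE X₀) / S.sdInf X₀ + S.sdSup X₀ ^ 2 / S.sdInf X₀ ^ 2 with hM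
  have hM0 : 0 ≤ M := by
    have := S.lowerE_le_E h.mem
    have := h.sdInf_pos
    have : 0 ≤ (S.E X₀ - S.lowerE X₀) / S.sdInf X₀ := div_nonneg (by linarith) this.le
    positivity
  set A := 2 * ℓ ^ (-p) * Real.sqrt n ^ (-p) with hA
  have hA0 : 0 ≤ A := by positivity
  -- Half of `ρ` pays for the ramps, the other half for the approximate majorant. The ramp width
  -- depends on neither `T` nor the history.
  have hτ : 0 < ρ / (2 * (M + 1)) := by positivity
  have hη : 0 < ρ / (2 * (A + 1)) := by positivity
  refine ⟨ρ / (2 * (M + 1)), hτ, fun T hT h01 μ sd hμ hsd hmem => ?_⟩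
  have hμm : μ ∈ S.meanInterval X₀ := hμ ▸ h.chosenMean_mem _ _
  obtain ⟨Y, hY, hYg, hEY⟩ := h.exists_dominating hp hs1 hμm hη
  have hl0 := h.sdLower_pos hμm
  have hlsd : S.sdLower X₀ μ ≤ sd := hsd ▸ (h.chosenSd_mem _ _ _).1
  set b := smoothMeanDeriv ℓ T 0
  set c := smoothMeanDeriv₂ ℓ T 0
  set q : Ω → ℝ := fun ω => b * ((X₀ ω - μ) / (sd * Real.sqrt n)) +
    c / 2 * ((X₀ ω - μ) / (sd * Real.sqrt n)) ^ 2 with hq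
  have hqm : q ∈ S.H := h.quadratic_mem b c μ _
  have hpt : ∀ ω, smoothMean ℓ T ((X₀ ω - μ) / (sd * Real.sqrt n)) ≤
      ((fun ω => q ω + smoothMean ℓ T 0) + fun ω => A * Y ω) ω := by
    intro ω
    set ξ := (X₀ ω - μ) / S.sdLower X₀ μ with hξ
    have t1 := (abs_le.1 (abs_smoothMean_taylor_le hℓ hT h01 0
      ((X₀ ω - μ) / (sd * Real.sqrt n)))).2
    -- The remainder bound is monotone and `sd` is at least the lower deviation, so the variable may
    -- be replaced by the one defining `γ`.
    have t2 : |(X₀ ω - μ) / (sd * Real.sqrt n) / ℓ| ≤ |ξ| / Real.sqrt n / ℓ := by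
      rw [abs_div, abs_div, abs_of_pos hℓ, abs_of_pos (mul_pos (hl0.trans_le hlsd) hs0), hξ,
        abs_div, abs_of_pos hl0, div_div _ (S.sdLower X₀ μ)]
      gcongr
    have t0 : 0 ≤ |ξ| / Real.sqrt n / ℓ := by positivity
    have t3 := taylor_bound_mono (t2.trans (le_abs_self _))
    rw [abs_of_nonneg t0] at t3
    have t4 := min_taylor_le hℓ hℓ1 hp hs0 (abs_nonneg ξ)
    rw [sq_abs ξ, ← hA] at t4
    have t5 := mul_le_mul_of_nonneg_left (hYg ω) hA0
    simp only [Pi.add_apply, hq]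
    rw [zero_add] at t1
    linarith
  have hq1 : (fun ω => q ω + smoothMean ℓ T 0) ∈ S.H := S.H.add_mem hqm (S.const_mem _)
  have hY1 : (fun ω => A * Y ω) ∈ S.H := S.H.smul_mem A hY
  have h1 := (S.mono _ hmem _ (S.H.add_mem hq1 hY1) hpt).trans (S.subadd _ hq1 _ hY1)
  rw [S.E_add_const hqm, S.E_const_mul hY hA0] at h1
  have h2 := h.E_quadratic_le hτ b c hs1
  rw [← hμ, ← hsd, ← hM, hsq] at h2
  change S.E q ≤ _ at h2
  have h3 := taylor_le_integral_smoothMean hℓ hT h01 hn v hv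
  have h4 : ρ / (2 * (M + 1)) * M ≤ ρ / 2 := by
    rw [div_mul_eq_mul_div, div_le_div_iff₀ (by positivity) (by positivity)]
    nlinarith
  have h5 : A * (ρ / (2 * (A + 1))) ≤ ρ / 2 := by
    rw [mul_div_assoc', div_le_div_iff₀ (by positivity) (by positivity)]
    nlinarith
  have h6 := mul_le_mul_of_nonneg_left hEY hA0
  linarith

end MomentCondition

end Gamma

end SublinearExpectation

/-! ### From rules on normalized increments to rules on observations -/

section Strategy

open Function

/-- The normalized increments obtained from the observations `x` when the mean and the standard
deviation at time `k` are functions `mr k` and `sr k` of the previous normalized increments. -/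
noncomputable def normalizedSeq (mr sr : ℕ → (ℕ → ℝ) → ℝ) (s : ℝ) : ℕ → (ℕ → ℝ) → ℕ → ℝ
  | 0 => fun _ => 0
  | k + 1 => fun x => update (normalizedSeq mr sr s k x) k
      ((x k - mr k (normalizedSeq mr sr s k x)) / (sr k (normalizedSeq mr sr s k x) * s))

variable {mr sr : ℕ → (ℕ → ℝ) → ℝ} {s : ℝ}

theorem continuous_normalizedSeq (hm : ∀ k, Continuous (mr k)) (hs : ∀ k, Continuous (sr k))
    (hpos : ∀ k z, 0 < sr k z) (hs0 : 0 < s) (k : ℕ) :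
    Continuous (normalizedSeq mr sr s k) := by
  induction k with
  | zero => exact continuous_const
  | succ k ih =>
    refine ih.update k (Continuous.div ?_ ?_ fun x => (mul_pos (hpos _ _) hs0).ne')
    · exact (continuous_apply k).sub ((hm k).comp ih)
    · exact ((hs k).comp ih).mul_const s

theorem normalizedSeq_congr {x y : ℕ → ℝ} (k : ℕ) (h : ∀ j < k, x j = y j) :
    normalizedSeq mr sr s k x = normalizedSeq mr sr s k y := by
  induction k with
  | zero => rfl
  | succ k ih =>
    simp only [normalizedSeq]
    rw [ih fun j hj => h j (by omega), h k (by omega)]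

theorem normalizedSeq_apply {n i : ℕ} (hi : i < n) (x : ℕ → ℝ) :
    normalizedSeq mr sr s n x i =
      (x i - mr i (normalizedSeq mr sr s i x)) / (sr i (normalizedSeq mr sr s i x) * s) := by
  induction n with
  | zero => omega
  | succ n ih =>
    simp only [normalizedSeq]
    rcases eq_or_ne i n with rfl | hne
    · rw [update_self]
    · rw [update_of_ne hne, ih (by omega)]

/-- Extension of a finite sequence by zeros. -/
def padSeq {k : ℕ} (x : Fin k → ℝ) : ℕ → ℝ := fun j => if h : j < k then x ⟨j, h⟩ else 0

theorem continuous_padSeq (k : ℕ) : Continuous (padSeq (k := k)) := by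
  refine continuous_pi fun j => ?_
  by_cases h : j < k
  · simp only [padSeq, h, dite_true]
    fun_prop
  · simp only [padSeq, h, dite_false]
    fun_prop

theorem normalizedSeq_padSeq_initialVec {Ω : Type*} (X : ℕ → Ω → ℝ) (k : ℕ) (ω : Ω) :
    normalizedSeq mr sr s k (padSeq (initialVec X k ω)) =
      normalizedSeq mr sr s k fun j => X (j + 1) ω := by
  refine normalizedSeq_congr k fun j hj => ?_
  simp [padSeq, hj, initialVec]

/-- The normalization given by rules in terms of the previous normalized increments. -/
noncomputable def ruleNormalization (mr sr : ℕ → (ℕ → ℝ) → ℝ) (s : ℝ) (n : ℕ) :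
    Normalization n where
  mean i x := mr i (normalizedSeq mr sr s i (padSeq x))
  sd i x := sr i (normalizedSeq mr sr s i (padSeq x))

theorem randomLine_ruleNormalization {Ω : Type*} (X : ℕ → Ω → ℝ) (n : ℕ) (ω : Ω) :
    randomLine X (ruleNormalization mr sr (Real.sqrt n) n) ω =
      brokenLine fun i : Fin n => normalizedSeq mr sr (Real.sqrt n) n (fun j => X (j + 1) ω) i := by
  unfold randomLine
  congr 1
  ext i
  rw [normalizedSeq_apply i.2]
  simp only [ruleNormalization, normalizedSeq_padSeq_initialVec]
  rw [one_div, inv_mul_eq_div, div_div]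

end Strategy

/-! ### Backward induction under the sublinear expectation -/

namespace SublinearExpectation

section Chain

variable {Ω : Type*} {S : SublinearExpectation Ω} {X : ℕ → Ω → ℝ}

/-- A continuous function with values in the unit interval, as a bounded continuous function. -/
def bcfOfMemIcc {α : Type*} [TopologicalSpace α] (G : α → ℝ) (hG : Continuous G)
    (h01 : ∀ x, G x ∈ Icc (0 : ℝ) 1) : α →ᵇ ℝ :=
  BoundedContinuousFunction.ofNormedAddCommGroup G hG 1 fun x => by
    rw [Real.norm_eq_abs, abs_of_nonneg (h01 x).1]
    exact (h01 x).2

theorem IsIIDWith.comp_initialVec_mem (hX : S.IsIIDWith X) (k : ℕ) {G : (Fin k → ℝ) → ℝ}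
    (hG : Continuous G) (h01 : ∀ x, G x ∈ Icc (0 : ℝ) 1) :
    (fun ω => G (initialVec X k ω)) ∈ S.H := by
  -- Independence is only assumed for nonempty histories; the empty history is a single point.
  rcases Nat.eq_zero_or_pos k with rfl | hk
  · have : (fun ω => G (initialVec X 0 ω)) = fun _ => G 0 := by
      ext ω
      congr 1
      exact Subsingleton.elim _ _
    rw [this]
    exact S.const_mem _
  · exact (hX.indep k hk (bcfOfMemIcc (fun q : (Fin k → ℝ) × ℝ => G q.1) (by fun_prop)
      fun q => h01 _)).1

theorem IsIIDWith.E_comp_eq (hX : S.IsIIDWith X) (k : ℕ) {G : ℝ → ℝ}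
    (hG : Continuous G) (h01 : ∀ x, G x ∈ Icc (0 : ℝ) 1) :
    (fun ω => G (X 0 ω)) ∈ S.H ∧ (fun ω => G (X (k + 1) ω)) ∈ S.H ∧
      S.E (fun ω => G (X (k + 1) ω)) = S.E (fun ω => G (X 0 ω)) := by
  have := hX.sameDistrib (k + 1) (by omega) (bcfOfMemIcc G hG h01)
  exact ⟨this.2.1, this.1, this.2.2⟩

/-- Conditioning on the first `k` variables bounds the upper expectation. -/
theorem IsIIDWith.E_le_of_section_le (hX : S.IsIIDWith X) (k : ℕ)
    {G : (Fin k → ℝ) → ℝ → ℝ} (hG : Continuous fun q : (Fin k → ℝ) × ℝ => G q.1 q.2)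
    (h01 : ∀ x y, G x y ∈ Icc (0 : ℝ) 1) {W : (Fin k → ℝ) → ℝ} (hW : Continuous W)
    (hW01 : ∀ x, W x ∈ Icc (0 : ℝ) 1) {e : ℝ}
    (hle : ∀ x, S.E (fun ω => G x (X 0 ω)) ≤ W x + e) :
    S.E (fun ω => G (initialVec X k ω) (X (k + 1) ω)) ≤
      S.E (fun ω => W (initialVec X k ω)) + e := by
  have hsec : ∀ x, S.E (fun ω => G x (X (k + 1) ω)) ≤ W x + e := fun x => by
    rw [(hX.E_comp_eq k (G := G x) (hG.comp (by fun_prop : Continuous fun y : ℝ => (x, y)))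
      (h01 x)).2.2]
    exact hle x
  have hWm := hX.comp_initialVec_mem k hW hW01
  rw [← S.E_add_const hWm]
  rcases Nat.eq_zero_or_pos k with rfl | hk
  · have e1 : (fun ω => G (initialVec X 0 ω) (X (0 + 1) ω)) = fun ω => G 0 (X (0 + 1) ω) := by
      ext ω
      congr 1
      exact Subsingleton.elim _ _
    have e2 : (fun ω => W (initialVec X 0 ω) + e) = fun _ => W 0 + e := by
      ext ω
      congr 2
      exact Subsingleton.elim _ _
    rw [e1, e2, S.const]
    exact hsec 0
  · obtain ⟨-, hm, heq⟩ := hX.indep k hk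
      (bcfOfMemIcc (fun q : (Fin k → ℝ) × ℝ => G q.1 q.2) hG fun q => h01 _ _)
    exact heq.le.trans (S.mono _ hm _ (S.H.add_mem hWm (S.const_mem e)) fun ω => hsec _)

/-- Backward induction along the normalized increments of the observations. -/
theorem IsIIDWith.E_chain_le (hX : S.IsIIDWith X) {mr sr : ℕ → (ℕ → ℝ) → ℝ} {s : ℝ}
    (hm : ∀ k, Continuous (mr k)) (hs : ∀ k, Continuous (sr k)) (hpos : ∀ k z, 0 < sr k z)
    (hs0 : 0 < s) {V : ℕ → (ℕ → ℝ) → ℝ} (hVc : ∀ k, Continuous (V k))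
    (hV01 : ∀ k z, V k z ∈ Icc (0 : ℝ) 1) {n : ℕ} {e : ℝ}
    (hstep : ∀ k < n, ∀ z, S.E (fun ω => V (k + 1)
      (Function.update z k ((X 0 ω - mr k z) / (sr k z * s)))) ≤ V k z + e)
    (k : ℕ) (hk : k ≤ n) :
    S.E (fun ω => V k (normalizedSeq mr sr s k (padSeq (initialVec X k ω)))) ≤
      V 0 0 + k * e := by
  induction k with
  | zero =>
    simp only [normalizedSeq, Nat.cast_zero, zero_mul, add_zero]
    exact (S.const _).le
  | succ k ih =>
    have hNp : Continuous fun x : Fin k → ℝ => normalizedSeq mr sr s k (padSeq x) :=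
      (continuous_normalizedSeq hm hs hpos hs0 k).comp (continuous_padSeq k)
    let G : (Fin k → ℝ) → ℝ → ℝ := fun x y => V (k + 1)
      (Function.update (normalizedSeq mr sr s k (padSeq x)) k
        ((y - mr k (normalizedSeq mr sr s k (padSeq x))) /
          (sr k (normalizedSeq mr sr s k (padSeq x)) * s)))
    have hG : Continuous fun q : (Fin k → ℝ) × ℝ => G q.1 q.2 := by
      refine (hVc _).comp (Continuous.update (hNp.comp continuous_fst) k
        (Continuous.div ?_ ?_ fun q => (mul_pos (hpos _ _) hs0).ne'))
      · exact continuous_snd.sub ((hm k).comp (hNp.comp continuous_fst))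
      · exact ((hs k).comp (hNp.comp continuous_fst)).mul_const _
    have e1 : (fun ω => V (k + 1) (normalizedSeq mr sr s (k + 1)
        (padSeq (initialVec X (k + 1) ω)))) = fun ω => G (initialVec X k ω) (X (k + 1) ω) := by
      ext ω
      simp only [G, normalizedSeq_padSeq_initialVec]
      rfl
    rw [e1]
    have h1 := hX.E_le_of_section_le k hG (fun _ _ => hV01 _ _)
      (W := fun x => V k (normalizedSeq mr sr s k (padSeq x))) ((hVc k).comp hNp)
      (fun _ => hV01 _ _) (e := e) fun x => hstep k (by omega) _
    have h2 := ih (by omega)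
    push_cast
    linarith

/-- The rule for the mean, from the slope of the next shadow step. -/
noncomputable def meanRule (S : SublinearExpectation Ω) (X₀ : Ω → ℝ) (τ ℓ : ℝ) (ν : Measure ℝ)
    (n : ℕ) (Φ : (ℕ → ℝ) → ℝ) (k : ℕ) (z : ℕ → ℝ) : ℝ :=
  S.chosenMean X₀ τ (smoothMeanDeriv ℓ (shadowStep ν (3 * ℓ / 2) n Φ (n - (k + 1)) z) 0)

/-- The rule for the standard deviation, from the curvature of the next shadow step. -/
noncomputable def sdRule (S : SublinearExpectation Ω) (X₀ : Ω → ℝ) (τ ℓ : ℝ) (ν : Measure ℝ)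
    (n : ℕ) (Φ : (ℕ → ℝ) → ℝ) (k : ℕ) (z : ℕ → ℝ) : ℝ :=
  S.chosenSd X₀ τ (S.meanRule X₀ τ ℓ ν n Φ k z)
    (smoothMeanDeriv₂ ℓ (shadowStep ν (3 * ℓ / 2) n Φ (n - (k + 1)) z) 0)

variable {ν : Measure ℝ} [IsProbabilityMeasure ν] {n : ℕ} {Φ : (ℕ → ℝ) → ℝ} {ℓ τ : ℝ}

theorem continuous_meanRule (hℓ : 0 ≤ ℓ) (hΦ : Continuous Φ) (h01 : ∀ z, Φ z ∈ Icc (0 : ℝ) 1)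
    (k : ℕ) : Continuous (S.meanRule (X 0) τ ℓ ν n Φ k) := by
  have hT := continuous_shadowStep (ν := ν) (n := n) (by linarith : 0 ≤ 3 * ℓ / 2) hΦ h01
    (n - (k + 1))
  have := (continuous_rampWeight τ).comp (continuous_smoothMeanDeriv_uncurry ℓ hT 0)
  exact (this.const_mul _).const_add _

theorem MomentCondition.continuous_sdRule (h : S.MomentCondition (X 0)) (hℓ : 0 ≤ ℓ)
    (hΦ : Continuous Φ) (h01 : ∀ z, Φ z ∈ Icc (0 : ℝ) 1) (k : ℕ) :
    Continuous (S.sdRule (X 0) τ ℓ ν n Φ k) := by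
  have hT := continuous_shadowStep (ν := ν) (n := n) (by linarith : 0 ≤ 3 * ℓ / 2) hΦ h01
    (n - (k + 1))
  exact (h.continuous_chosenSd τ).comp ((continuous_meanRule hℓ hΦ h01 k).prodMk
    (continuous_smoothMeanDeriv₂_uncurry ℓ hT 0))

/-- For a suitable admissible normalization, the upper probability of an event is bounded by the
smoothed value of any continuous majorant of its indicator. -/
theorem exists_admissible_upperProb_le (hX : S.IsIIDWith X) (h : S.MomentCondition (X 0))
    (hn : 1 ≤ n) {p : ℝ} (hp : p ∈ Icc (2 : ℝ) 3) (hℓ : 0 < ℓ) (hℓ1 : ℓ ≤ 1) {v : NNReal}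
    (hv : (v : ℝ) = 1 / n) {ρ : ℝ} (hρ : 0 < ρ) (hΦ : Continuous Φ)
    (h01 : ∀ z, Φ z ∈ Icc (0 : ℝ) 1) (D : Set C(I, ℝ))
    (hD : ∀ z : ℕ → ℝ, brokenLine (fun i : Fin n => z i) ∈ D → Φ z = 1) :
    ∃ c ∈ S.admissible (X 0) n, S.upperProb X n {ω | randomLine X c ω ∈ D} ≤
      smoothValue (gaussianReal 0 v) ℓ n Φ n 0 +
      n * (2 * ℓ ^ (-p) * Real.sqrt n ^ (-p) * (S.gammaSup (X 0) p (Real.sqrt n)).toReal +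
          4 / 3 / (ℓ * Real.sqrt n) ^ 3 + ρ) := by
  have hs0 : 0 < Real.sqrt n := Real.sqrt_pos.2 (by exact_mod_cast hn)
  obtain ⟨τ, hτ, hstep⟩ := h.exists_smoothMean_step_le hn hp hℓ hℓ1 hv hρ
  set err := 2 * ℓ ^ (-p) * Real.sqrt n ^ (-p) * (S.gammaSup (X 0) p (Real.sqrt n)).toReal +
    4 / 3 / (ℓ * Real.sqrt n) ^ 3 + ρ
  set ν := gaussianReal 0 v
  set mr := S.meanRule (X 0) τ ℓ ν n Φ
  set sr := S.sdRule (X 0) τ ℓ ν n Φ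
  set N := normalizedSeq mr sr (Real.sqrt n)
  have hmc : ∀ k, Continuous (mr k) := continuous_meanRule hℓ.le hΦ h01
  have hsc : ∀ k, Continuous (sr k) := h.continuous_sdRule hℓ.le hΦ h01
  have hmm : ∀ k z, mr k z ∈ S.meanInterval (X 0) := fun k z => h.chosenMean_mem _ _
  have hsm : ∀ k z, sr k z ∈ Icc (S.sdLower (X 0) (mr k z)) (S.sdUpper (X 0) (mr k z)) :=
    fun k z => h.chosenSd_mem _ _ _
  have hspos : ∀ k z, 0 < sr k z := fun k z => (h.sdLower_pos (hmm k z)).trans_le (hsm k z).1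
  have hNc : ∀ k, Continuous (N k) := continuous_normalizedSeq hmc hsc hspos hs0
  have hVc := continuous_smoothValue (ν := ν) (n := n) hℓ.le hΦ h01
  have hV01 := smoothValue_mem_Icc (ν := ν) (n := n) hℓ.le hΦ h01
  have hr : 0 ≤ 3 * ℓ / 2 := by linarith
  -- One step of the recursion: domination by a smooth function of the increment, Gaussian
  -- replacement, and identification of the Gaussian average. Time `k` corresponds to `n - k`
  -- remaining steps.
  have hinner : ∀ k < n, ∀ z, S.E (fun ω => smoothValue ν ℓ n Φ (n - (k + 1))
      (Function.update z k ((X 0 ω - mr k z) / (sr k z * Real.sqrt n)))) ≤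
      smoothValue ν ℓ n Φ (n - k) z + err := by
    intro k hk z
    have hTc : Continuous (shadowStep ν (3 * ℓ / 2) n Φ (n - (k + 1)) z) :=
      (continuous_shadowStep (ν := ν) (n := n) hr hΦ h01 (n - (k + 1))).comp
        (by fun_prop : Continuous fun t : ℝ => (z, t))
    have hT01 := shadowStep_mem_Icc (ν := ν) (n := n) hr hΦ h01 (n - (k + 1)) z
    have hy : Continuous fun y : ℝ => (y - mr k z) / (sr k z * Real.sqrt n) := by fun_prop
    have m1 := (hX.E_comp_eq 0 (G := fun y => smoothValue ν ℓ n Φ (n - (k + 1))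
      (Function.update z k ((y - mr k z) / (sr k z * Real.sqrt n))))
      ((hVc _).comp (continuous_const.update k hy)) (fun _ => hV01 _ _)).1
    have m2 := (hX.E_comp_eq 0 (G := fun y => smoothMean ℓ
      (shadowStep ν (3 * ℓ / 2) n Φ (n - (k + 1)) z) ((y - mr k z) / (sr k z * Real.sqrt n)))
      ((continuous_windowMean ℓ (continuous_windowMean ℓ
        (continuous_windowMean ℓ hTc))).comp hy)
      (fun _ => smoothMean_mem_Icc hℓ.le hTc hT01 _)).1
    refine (S.mono _ m1 _ m2 fun ω => ?_).trans ?_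
    · have := smoothValue_update_le (ν := ν) (n := n) hℓ.le hΦ h01 (n - (k + 1)) z
        ((X 0 ω - mr k z) / (sr k z * Real.sqrt n))
      rwa [show n - (n - (k + 1) + 1) = k by omega] at this
    · have := hstep _ hTc hT01 _ _ rfl rfl m2
      rwa [integral_smoothMean_shadowStep hℓ.le hΦ h01,
        show n - (k + 1) + 1 = n - k by omega] at this
  have hchain := hX.E_chain_le hmc hsc hspos hs0 (V := fun k => smoothValue ν ℓ n Φ (n - k))
    (fun k => hVc _) (fun k z => hV01 _ z) hinner n le_rfl
  refine ⟨ruleNormalization mr sr (Real.sqrt n) n, fun i => ?_, ?_⟩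
  · have hNp : Continuous fun x : Fin (i : ℕ) → ℝ => N i (padSeq x) :=
      (hNc i).comp (continuous_padSeq i)
    refine ⟨(hmc i).comp hNp, (hsc i).comp hNp, fun x => ?_⟩
    exact ⟨hmm _ _, sdInf_le_sdLower (hmm _ _), (hsm _ _).1, (hsm _ _).2, h.le_sdSup (hmm _ _)⟩
  · refine (csInf_le ⟨0, ?_⟩ ?_).trans hchain
    · rintro _ ⟨ψ, hψ, hle, rfl⟩
      refine S.E_nonneg hψ fun ω => le_trans ?_ (hle ω)
      exact indicator_nonneg (fun _ _ => zero_le_one) _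
    -- With no steps remaining the smoothed value is `Φ` itself, a majorant of the indicator.
    · refine ⟨fun x => smoothValue ν ℓ n Φ (n - n) (N n (padSeq x)), ?_, fun ω => ?_, rfl⟩
      · exact hX.comp_initialVec_mem n ((hVc _).comp ((hNc n).comp (continuous_padSeq n)))
          fun _ => hV01 _ _
      · simp only [Nat.sub_self, smoothValue_zero]
        by_cases hω : randomLine X (ruleNormalization mr sr (Real.sqrt n) n) ω ∈ D
        · rw [randomLine_ruleNormalization] at hω
          simp only [N, normalizedSeq_padSeq_initialVec]
          rw [hD _ hω]
          exact indicator_le_self' (fun _ _ => zero_le_one) ω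
        · rw [indicator_of_notMem (by exact hω)]
          exact (h01 _).1

end Chain

end SublinearExpectation

/-! ### The smoothed value against the law of `f(B)` -/

section WienerBound

variable {Ω' : Type*} [MeasurableSpace Ω'] {P : Measure Ω'} [IsProbabilityMeasure P]
  {B : Ω' → C(I, ℝ)} {f : C(I, ℝ) → ℝ} {L : ℝ}

/-- The function that is `1` up to `a`, `0` from `a + κ` on and linear in between. -/
noncomputable def downRamp (a κ x : ℝ) : ℝ := max 0 (min 1 ((a + κ - x) / κ))

theorem downRamp_mem_Icc (a κ x : ℝ) : downRamp a κ x ∈ Icc (0 : ℝ) 1 :=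
  ⟨le_max_left _ _, max_le zero_le_one (min_le_left _ _)⟩

theorem downRamp_of_le {a κ x : ℝ} (hκ : 0 < κ) (hx : x ≤ a) : downRamp a κ x = 1 := by
  rw [downRamp, min_eq_left ((one_le_div hκ).2 (by linarith)), max_eq_right zero_le_one]

theorem downRamp_of_ge {a κ x : ℝ} (hκ : 0 < κ) (hx : a + κ ≤ x) : downRamp a κ x = 0 := by
  rw [downRamp, max_eq_left]
  exact (min_le_right _ _).trans (div_nonpos_of_nonpos_of_nonneg (by linarith) hκ.le)

/-- The ramp at level `a` of `f`, evaluated at the broken line with `n` given increments. -/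
noncomputable def lineRamp (f : C(I, ℝ) → ℝ) (a κ : ℝ) (n : ℕ) (z : ℕ → ℝ) : ℝ :=
  downRamp a κ (f (brokenLine fun i : Fin n => z i))

theorem continuous_comp_brokenLine (hf : Continuous f) (n : ℕ) :
    Continuous fun z : ℕ → ℝ => f (brokenLine fun i : Fin n => z i) :=
  hf.comp ((continuous_brokenLine n).comp (by fun_prop))

theorem continuous_lineRamp (hf : Continuous f) (a κ : ℝ) (n : ℕ) :
    Continuous (lineRamp f a κ n) := by
  have h : Continuous (downRamp a κ) := by
    unfold downRamp
    fun_prop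
  exact h.comp (continuous_comp_brokenLine hf n)

/-- The ramp costs `κ`, the distance from path to shadow `3ℓ`, and the distance from the broken line
to `B` costs `δ` outside an event of Gaussian tail probability. -/
theorem IsWienerProcess.smoothValue_le (hB : IsWienerProcess B P)
    (hL : ∀ x y : C(I, ℝ), |f x - f y| ≤ L * ‖x - y‖) (hL0 : 0 ≤ L) {n : ℕ} (hn : 1 ≤ n)
    {a κ δ ℓ : ℝ} (hκ : 0 < κ) (hδ : 0 < δ) (hℓ : 0 ≤ ℓ) :
    smoothValue (gaussianReal 0 (Real.toNNReal (1 / n))) ℓ n (lineRamp f a κ n) n 0 ≤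
      P.real {ω | f (B ω) ≤ a + κ + L * (3 * ℓ) + L * δ} +
        n * (2 * Real.exp (-(δ ^ 2 * n / 8))) := by
  have hn' : (0 : ℝ) < n := by exact_mod_cast hn
  have hf : Continuous f := by
    refine (LipschitzWith.of_dist_le_mul (K := L.toNNReal) fun x y => ?_).continuous
    rw [Real.dist_eq, dist_eq_norm, Real.coe_toNNReal _ hL0]
    exact hL x y
  set v := Real.toNNReal (1 / n)
  let A : Set (ℕ → ℝ) := {z | f (brokenLine fun i : Fin n => z i) ≤ a + κ + L * (3 * ℓ)}
  have hA : MeasurableSet A :=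
    (isClosed_le (continuous_comp_brokenLine hf n) continuous_const).measurableSet
  let U : (ℕ → ℝ) → ENNReal := A.indicator 1
  have hU : Measurable U := measurable_one.indicator hA
  have h1 : ENNReal.ofReal (smoothValue (gaussianReal 0 v) ℓ n (lineRamp f a κ n) n 0) ≤
      tailIntegral (gaussianReal 0 v) n U n 0 := by
    refine ofReal_smoothValue_le hℓ (continuous_lineRamp hf a κ n) (fun _ => downRamp_mem_Icc _ _ _)
      fun z w hzw => ?_
    have hd := norm_brokenLine_sub_le hn z w hzw
    by_cases hw : w ∈ A
    · simp only [U, indicator_of_mem hw, Pi.one_apply]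
      rw [← ENNReal.ofReal_one]
      exact ENNReal.ofReal_le_ofReal (downRamp_mem_Icc _ _ _).2
    · have hw' : a + κ + L * (3 * ℓ) < f (brokenLine fun i : Fin n => w i) := not_le.1 hw
      have h2 := (abs_le.1 (hL (brokenLine fun i : Fin n => z i)
        (brokenLine fun i : Fin n => w i))).1
      have h3 := mul_le_mul_of_nonneg_left hd hL0
      have h4 : lineRamp f a κ n z = 0 := downRamp_of_ge hκ (by linarith)
      rw [h4]
      simp
  have ht := monotone_arithTimes 0 (d := 1 / n) (by positivity)
  have h2 := lintegral_truncateSeq_eq_tailIntegral (ν := gaussianReal 0 v) (n := n)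
    (hB.iIndepFun_pathIncrement ht)
    (hB.hasLaw_pathIncrement ht) (fun k hk => by
      rw [arithTimes_succ_sub le_rfl (by positivity) (N := n) (by
        rw [mul_one_div, div_self hn'.ne', zero_add]) hk]) hU
  rw [← h2] at h1
  have h3 : ∫⁻ ω, U (truncateSeq n fun j => pathIncrement (arithTimes 0 (1 / n)) (B ω) j) ∂P ≤
      P {ω | f (B ω) ≤ a + κ + L * (3 * ℓ) + L * δ} +
        n * ENNReal.ofReal (2 * Real.exp (-(δ ^ 2 * n / 8))) := by
    refine (lintegral_indicator_one_le
      ((fun ω => truncateSeq n fun j => pathIncrement (arithTimes 0 (1 / n)) (B ω) j) ⁻¹' A)).trans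
      ?_
    refine le_trans ?_ (add_le_add le_rfl (hB.measure_norm_sub_brokenLine_gt_le hn hδ))
    refine (measure_mono fun ω hω => ?_).trans (measure_union_le _ _)
    have hω' : f (brokenLine fun i : Fin n => pathIncrement (arithTimes 0 (1 / n)) (B ω) i) ≤
        a + κ + L * (3 * ℓ) := by
      have hz : (fun i : Fin n => (truncateSeq n fun j =>
          pathIncrement (arithTimes 0 (1 / n)) (B ω) j) i) =
          fun i : Fin n => pathIncrement (arithTimes 0 (1 / n)) (B ω) i := by
        ext i
        simp [truncateSeq]
      rw [← hz]
      exact hω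
    rcases le_or_gt ‖B ω - brokenLine fun i : Fin n =>
      pathIncrement (arithTimes 0 (1 / n)) (B ω) i‖ δ with hle | hgt
    · left
      have h4 := (abs_le.1 (hL (B ω) (brokenLine fun i : Fin n =>
        pathIncrement (arithTimes 0 (1 / n)) (B ω) i))).2
      have h5 := mul_le_mul_of_nonneg_left hle hL0
      rw [mem_ofPred_eq]
      linarith
    · right
      exact hgt
  have hexp : 0 ≤ 2 * Real.exp (-(δ ^ 2 * n / 8)) := by positivity
  rw [Measure.real, ← ENNReal.ofReal_le_ofReal_iff (by positivity),
    ENNReal.ofReal_add ENNReal.toReal_nonneg (by positivity), ENNReal.ofReal_toReal (by simp),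
    ENNReal.ofReal_mul hn'.le, ENNReal.ofReal_natCast]
  exact h1.trans h3

theorem measureReal_le_add {K : ℝ} {F : Ω' → ℝ}
    (hK : ∀ a h : ℝ, 0 ≤ h → P.real {ω | a ≤ F ω ∧ F ω ≤ a + h} ≤ K * h) (a : ℝ) {t : ℝ}
    (ht : 0 ≤ t) : P.real {ω | F ω ≤ a + t} ≤ P.real {ω | F ω ≤ a} + K * t := by
  refine le_trans ?_ (add_le_add le_rfl (hK a t ht))
  refine (measureReal_mono fun ω hω => ?_).trans (measureReal_union_le _ _)
  rcases le_total (F ω) a with h | h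
  · exact Or.inl h
  · exact Or.inr ⟨h, hω⟩

end WienerBound

/-! ### Arithmetic of the rate -/

section Rate

variable {γ p ε : ℝ} {n : ℕ}

/-- The exponent of `n` in the rate is largest at `p = 3`, where it is `1/8`, and `4.7 · 23/27 > 4`.
Hence `ε√n / 4 ≥ 1` always, and `ε < 1` forces `n` to be large. -/
theorem four_le_rate_mul (hγ : 23 / 27 ≤ γ) (hn : 1 ≤ n) (hp : p ∈ Icc (2 : ℝ) 3)
    (hε : ε = 4.7 * γ ^ (1 / (p + 1)) / (n : ℝ) ^ ((p - 2) / (2 * p + 2))) :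
    4 ≤ ε * (n : ℝ) ^ (1 / 8 : ℝ) := by
  have hn' : (1 : ℝ) ≤ n := by exact_mod_cast hn
  have hp1 := hp.1
  have hp2 := hp.2
  have h1 : (n : ℝ) ^ ((p - 2) / (2 * p + 2)) ≤ (n : ℝ) ^ (1 / 8 : ℝ) := by
    refine Real.rpow_le_rpow_of_exponent_le hn' ?_
    rw [div_le_div_iff₀ (by linarith) (by norm_num)]
    linarith
  have h2 : 23 / 27 ≤ γ ^ (1 / (p + 1)) := by
    calc (23 / 27 : ℝ) = (23 / 27 : ℝ) ^ (1 : ℝ) := (Real.rpow_one _).symm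
      _ ≤ (23 / 27 : ℝ) ^ (1 / (p + 1)) := by
        refine Real.rpow_le_rpow_of_exponent_ge (by norm_num) (by norm_num) ?_
        rw [div_le_one (by linarith)]
        linarith
      _ ≤ γ ^ (1 / (p + 1)) := Real.rpow_le_rpow (by norm_num) hγ (by
        have : 0 < p + 1 := by linarith
        positivity)
  have h3 : 0 < (n : ℝ) ^ ((p - 2) / (2 * p + 2)) := by positivity
  rw [hε, div_mul_eq_mul_div, le_div_iff₀ h3]
  have h4 : 4 ≤ 4.7 * γ ^ (1 / (p + 1)) := by linarith
  gcongr

theorem rpow_rate (hγ : 0 ≤ γ) (hn : 1 ≤ n) (hp : p ∈ Icc (2 : ℝ) 3)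
    (hε : ε = 4.7 * γ ^ (1 / (p + 1)) / (n : ℝ) ^ ((p - 2) / (2 * p + 2))) :
    n * (Real.sqrt n ^ (-p) * γ) = (ε / 4.7) ^ (p + 1) := by
  have hn' : (0 : ℝ) < n := by exact_mod_cast hn
  have hp1 : 0 < p + 1 := by linarith [hp.1]
  have e : ε / 4.7 = γ ^ (1 / (p + 1)) / (n : ℝ) ^ ((p - 2) / (2 * p + 2)) := by
    rw [hε]
    ring
  rw [e, Real.div_rpow (by positivity) (by positivity), ← Real.rpow_mul hγ,
    ← Real.rpow_mul hn'.le, one_div_mul_cancel hp1.ne', Real.rpow_one, Real.sqrt_eq_rpow,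
    ← Real.rpow_mul hn'.le, ← mul_assoc, mul_comm, div_eq_mul_inv γ, ← Real.rpow_neg hn'.le]
  congr 1
  nth_rw 1 [← Real.rpow_one (n : ℝ)]
  rw [← Real.rpow_add hn']
  congr 1
  field_simp
  ring

/-- By `rpow_rate`, `n` steps at width `ε/4` cost `2 (ε/4)^(-p) (ε/4.7)^(p+1)`, about `0.31 ε` at
worst. The Gaussian remainder is compared with the same quantity through `γ ≥ 23/27` and adds about
`0.24 ε`. -/
theorem lindeberg_error_le (hγ : 23 / 27 ≤ γ) (hn : 1 ≤ n) (hp : p ∈ Icc (2 : ℝ) 3)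
    (hε : ε = 4.7 * γ ^ (1 / (p + 1)) / (n : ℝ) ^ ((p - 2) / (2 * p + 2))) :
    n * (2 * (ε / 4) ^ (-p) * Real.sqrt n ^ (-p) * γ + 4 / 3 / (ε / 4 * Real.sqrt n) ^ 3) ≤
      0.6 * ε := by
  have hn' : (1 : ℝ) ≤ n := by exact_mod_cast hn
  have hs : 0 < Real.sqrt n := Real.sqrt_pos.2 (by linarith)
  have h4 := four_le_rate_mul hγ hn hp hε
  have hm : (n : ℝ) ^ (1 / 8 : ℝ) ≤ Real.sqrt n := by
    rw [Real.sqrt_eq_rpow]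
    exact Real.rpow_le_rpow_of_exponent_le hn' (by norm_num)
  have hγ0 : 0 < γ := by linarith
  have hε0 : 0 < ε := by
    rw [hε]
    positivity
  have hG := rpow_rate hγ0.le hn hp hε
  have hhs : 1 ≤ ε / 4 * Real.sqrt n := by nlinarith
  have key : (ε / 4) ^ (-p) * (ε / 4.7) ^ (p + 1) ≤ (4 / 4.7) ^ 2 / 4.7 * ε := by
    rw [Real.rpow_add_one (by positivity), Real.rpow_neg (by positivity)]
    have e : ((ε / 4) ^ p)⁻¹ * ((ε / 4.7) ^ p * (ε / 4.7)) = (4 / 4.7) ^ p * (ε / 4.7) := by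
      rw [← mul_assoc, inv_mul_eq_div, ← Real.div_rpow (by positivity) (by positivity)]
      congr 2
      field_simp
    rw [e]
    have : (4 / 4.7 : ℝ) ^ p ≤ (4 / 4.7) ^ 2 := by
      have := Real.rpow_le_rpow_of_exponent_ge (by norm_num : (0 : ℝ) < 4 / 4.7) (by norm_num) hp.1
      simpa only [Real.rpow_ofNat] using this
    calc (4 / 4.7 : ℝ) ^ p * (ε / 4.7) ≤ (4 / 4.7) ^ 2 * (ε / 4.7) := by gcongr
      _ = _ := by ring
  have t1 : n * (2 * (ε / 4) ^ (-p) * Real.sqrt n ^ (-p) * γ) =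
      2 * ((ε / 4) ^ (-p) * (ε / 4.7) ^ (p + 1)) := by
    rw [← hG]
    ring
  have t2 : n * (4 / 3 / (ε / 4 * Real.sqrt n) ^ 3) ≤
      4 / 3 * (27 / 23) * ((ε / 4) ^ (-p) * (ε / 4.7) ^ (p + 1)) := by
    have h1 : 1 / (ε / 4 * Real.sqrt n) ^ 3 ≤ (ε / 4) ^ (-p) * Real.sqrt n ^ (-p) := by
      rw [← Real.mul_rpow (by positivity) hs.le, Real.rpow_neg (by positivity), ← one_div]
      refine one_div_le_one_div_of_le (by positivity) ?_
      have := Real.rpow_le_rpow_of_exponent_le hhs hp.2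
      simpa only [Real.rpow_ofNat] using this
    have h2 : 1 ≤ 27 / 23 * γ := by linarith
    rw [← hG]
    calc n * (4 / 3 / (ε / 4 * Real.sqrt n) ^ 3) =
          4 / 3 * n * (1 / (ε / 4 * Real.sqrt n) ^ 3) * 1 := by ring
      _ ≤ 4 / 3 * n * ((ε / 4) ^ (-p) * Real.sqrt n ^ (-p)) * (27 / 23 * γ) := by gcongr
      _ = _ := by ring
  rw [mul_add, t1]
  norm_num at key t2 ⊢
  linarith

/-- With `m = n^(1/8)`, both `εm ≥ 4` and, as `ε < 1`, `m ≥ 4`. The exponent is then at least `0.08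
m⁶`, and `exp x ≥ x³/6` beats the factor `n = m⁸` with room to spare. -/
theorem gaussian_tail_le_rate (hγ : 23 / 27 ≤ γ) (hn : 1 ≤ n) (hp : p ∈ Icc (2 : ℝ) 3)
    (hε : ε = 4.7 * γ ^ (1 / (p + 1)) / (n : ℝ) ^ ((p - 2) / (2 * p + 2))) (hε1 : ε < 1) :
    n * (2 * Real.exp (-((ε / 5) ^ 2 * n / 8))) ≤ 0.3 * ε := by
  have hn' : (1 : ℝ) ≤ n := by exact_mod_cast hn
  have h4 := four_le_rate_mul hγ hn hp hε
  have hm1 : 1 ≤ (n : ℝ) ^ (1 / 8 : ℝ) := Real.one_le_rpow hn' (by norm_num)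
  have hm8 : ((n : ℝ) ^ (1 / 8 : ℝ)) ^ 8 = n := by
    rw [← Real.rpow_natCast, ← Real.rpow_mul (by linarith)]
    norm_num
  set m := (n : ℝ) ^ (1 / 8 : ℝ)
  have hm4 : 4 ≤ m := by nlinarith
  have hx : 0.08 * m ^ 6 ≤ (ε / 5) ^ 2 * n / 8 := by
    rw [← hm8]
    have : 16 ≤ (ε * m) ^ 2 := by nlinarith
    have h6 : 0 ≤ m ^ 6 := by positivity
    calc 0.08 * m ^ 6 = 16 * m ^ 6 / 200 := by ring
      _ ≤ (ε * m) ^ 2 * m ^ 6 / 200 := by gcongr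
      _ = _ := by ring
  set x := (ε / 5) ^ 2 * n / 8
  have hx0 : 0 ≤ x := by positivity
  have hexp : x ^ 3 / 6 ≤ Real.exp x := by
    have := Real.pow_div_factorial_le_exp x hx0 3
    norm_num [Nat.factorial] at this
    exact this
  have h3 : (0.08 * m ^ 6) ^ 3 / 6 ≤ Real.exp x := le_trans (by gcongr) hexp
  rw [Real.exp_neg, ← div_eq_mul_inv, mul_div_assoc', div_le_iff₀ (Real.exp_pos x), ← hm8]
  have h9 : (4 : ℝ) ^ 9 ≤ m ^ 9 := by gcongr
  have hε0 : 0 ≤ ε := by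
    by_contra hneg
    nlinarith
  have h5 : m ^ 8 * 2 ≤ 0.3 * 4 * ((0.08 : ℝ) ^ 3 / 6) * m ^ 17 := by
    have h8 : 0 < m ^ 8 := by positivity
    have : (2 : ℝ) ≤ 0.3 * 4 * ((0.08 : ℝ) ^ 3 / 6) * m ^ 9 := by
      norm_num at h9 ⊢
      linarith
    calc m ^ 8 * 2 ≤ m ^ 8 * (0.3 * 4 * ((0.08 : ℝ) ^ 3 / 6) * m ^ 9) := by gcongr
      _ = _ := by ring
  calc m ^ 8 * 2 ≤ 0.3 * 4 * ((0.08 : ℝ) ^ 3 / 6) * m ^ 17 := h5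
    _ ≤ 0.3 * (ε * m) * ((0.08 : ℝ) ^ 3 / 6) * m ^ 17 := by gcongr
    _ = 0.3 * ε * ((0.08 * m ^ 6) ^ 3 / 6) := by ring
    _ ≤ 0.3 * ε * Real.exp x := by gcongr

end Rate

/-! ### Assembling the bound -/

namespace SublinearExpectation

variable {Ω : Type*} {S : SublinearExpectation Ω}

theorem upperProb_nonneg (X : ℕ → Ω → ℝ) (n : ℕ) (A : Set Ω) : 0 ≤ S.upperProb X n A := by
  refine Real.sInf_nonneg ?_
  rintro _ ⟨ψ, hψ, hle, rfl⟩
  refine S.E_nonneg hψ fun ω => le_trans ?_ (hle ω)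
  exact indicator_nonneg (fun _ _ => zero_le_one) _

theorem upperProb_le_one (X : ℕ → Ω → ℝ) (n : ℕ) (A : Set Ω) : S.upperProb X n A ≤ 1 := by
  refine csInf_le ⟨0, ?_⟩ ⟨fun _ => 1, S.const_mem 1, fun ω => ?_, (S.const 1).symm⟩
  · rintro _ ⟨ψ, hψ, hle, rfl⟩
    refine S.E_nonneg hψ fun ω => le_trans ?_ (hle ω)
    exact indicator_nonneg (fun _ _ => zero_le_one) _
  · exact indicator_le_self' (fun _ _ => zero_le_one) ω

end SublinearExpectation

theorem corollary2p2 {Ω Ω' : Type*} [MeasurableSpace Ω']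
    (S : SublinearExpectation Ω) (X : ℕ → Ω → ℝ)
    (hX : S.IsIIDWith X) (hX₀ : S.MomentCondition (X 0))
    (P : Measure Ω') [IsProbabilityMeasure P] (B : Ω' → C(I, ℝ)) (hB : IsWienerProcess B P)
    (f : C(I, ℝ) → ℝ) (L K : ℝ)
    (hL : ∀ x y : C(I, ℝ), |f x - f y| ≤ L * ‖x - y‖)
    (hK : ∀ a h : ℝ, 0 ≤ h → P.real {ω | a ≤ f (B ω) ∧ f (B ω) ≤ a + h} ≤ K * h)
    (n : ℕ) (hn : 1 ≤ n) (p : ℝ) (hp : p ∈ Icc (2 : ℝ) 3) (a : ℝ) :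
    sInf ((fun c : Normalization n => S.upperProb X n {ω | f (randomLine X c ω) ≤ a}) ''
        S.admissible (X 0) n) - P.real {ω | f (B ω) ≤ a}
      ≤ (K * L + 1) * S.prokhorovRate (X 0) n p := by
  have hn' : (1 : ℝ) ≤ n := by exact_mod_cast hn
  have hL0 : 0 ≤ L := by
    have := (abs_nonneg _).trans (hL 1 0)
    simpa using this
  have hK0 : 0 ≤ K := by
    have := measureReal_nonneg.trans (hK 0 1 zero_le_one)
    linarith
  have hKL : 0 ≤ K * L := mul_nonneg hK0 hL0
  have hP0 : 0 ≤ P.real {ω | f (B ω) ≤ a} := measureReal_nonneg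
  have hbdd : BddBelow ((fun c : Normalization n =>
      S.upperProb X n {ω | f (randomLine X c ω) ≤ a}) '' S.admissible (X 0) n) :=
    ⟨0, by rintro _ ⟨c, -, rfl⟩; exact SublinearExpectation.upperProb_nonneg _ _ _⟩
  have hγ := hX₀.le_toReal_gammaSup hp (Real.one_le_sqrt.2 hn')
  obtain ⟨ε, hε⟩ : ∃ ε, ε = S.prokhorovRate (X 0) n p := ⟨_, rfl⟩
  rw [← hε]
  rw [SublinearExpectation.prokhorovRate] at hε
  set γ := (S.gammaSup (X 0) p (Real.sqrt n)).toReal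
  have hε0 : 0 < ε := by
    rw [hε]
    have : 0 < γ := by linarith
    positivity
  -- For `ε ≥ 1` the bound is trivial, as upper probabilities are at most `1`.
  rcases le_or_gt 1 ε with hε1 | hε1
  · have h1 : sInf ((fun c : Normalization n =>
        S.upperProb X n {ω | f (randomLine X c ω) ≤ a}) '' S.admissible (X 0) n) ≤ 1 := by
      rcases (S.admissible (X 0) n).eq_empty_or_nonempty with he | ⟨c, hc⟩
      · rw [he, image_empty, Real.sInf_empty]
        exact zero_le_one
      · exact (csInf_le hbdd (mem_image_of_mem _ hc)).trans
          (SublinearExpectation.upperProb_le_one _ _ _)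
    nlinarith
  · have hf : Continuous f := by
      refine (LipschitzWith.of_dist_le_mul (K := L.toNNReal) fun x y => ?_).continuous
      rw [Real.dist_eq, dist_eq_norm, Real.coe_toNNReal _ hL0]
      exact hL x y
    have hκ : 0 < 0.05 * ε / (K + 1) := by positivity
    have hρ : 0 < 0.05 * ε / n := by positivity
    -- The budget: `3ℓ + δ = 3ε/4 + ε/5 < ε` in the coefficient of `KL`. The remaining terms are
    -- `0.6` (Lindeberg), `0.3` (tail), `0.05` (from `ρ`) and `0.05` (from `κ`), which sum to `1`.
    obtain ⟨c, hc, hle⟩ := SublinearExpectation.exists_admissible_upperProb_le hX hX₀ hn hp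
      (ℓ := ε / 4) (by positivity) (by linarith) (v := Real.toNNReal (1 / n))
      (Real.coe_toNNReal _ (by positivity)) hρ
      (continuous_lineRamp hf a (0.05 * ε / (K + 1)) n) (fun _ => downRamp_mem_Icc _ _ _)
      {x | f x ≤ a} fun z hz => downRamp_of_le hκ hz
    have h1 := csInf_le hbdd (mem_image_of_mem _ hc)
    have h2 := hB.smoothValue_le hL hL0 hn (a := a) hκ (δ := ε / 5) (by positivity)
      (ℓ := ε / 4) (by positivity)
    have h3 := measureReal_le_add hK a
      (t := 0.05 * ε / (K + 1) + L * (3 * (ε / 4)) + L * (ε / 5)) (by positivity)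
    have h4 := lindeberg_error_le hγ hn hp hε
    have h5 := gaussian_tail_le_rate hγ hn hp hε hε1
    have h6 : K * (0.05 * ε / (K + 1)) ≤ 0.05 * ε := by
      rw [mul_div_assoc', div_le_iff₀ (by positivity)]
      nlinarith
    have h7 : n * (0.05 * ε / n) = 0.05 * ε := by field_simp
    rw [mul_add (n : ℝ), h7] at hle
    simp only [← add_assoc] at h3
    have h8 : 0 ≤ K * L * ε := by positivity
    have hle' : S.upperProb X n {ω | f (randomLine X c ω) ≤ a} ≤ _ := hle
    rw [mul_add, mul_add] at h3
    norm_num at h2 h3 h4 h5 h6 hle' ⊢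
    linarith
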